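/- A finite simple graph $G=(V,E)$ is $(k,\ell)$-anonymous if for each vertex $v$ there is a set $U\subseteq V\setminus\{v\}$ with $|U|\ge k$ such that each $u\in U$ has at least $\ell$ common neighbours with $v$. **Theorem.** There is a randomized algorithm (using independent fair coin tosses) which, given a simple graph $G$ on $n$ vertices and integers $k',k,\ell\ge 0$, always halts after a number of steps that is polynomial in $n$, returns a graph $G_1$ on the same vertices, and has the following property. For every constant $\epsilon>0$ there are constants $C$ and $n_0$ (depending only on $\epsilon$) such that, whenever $n\ge n_0$, $k'\le k$, $\ell\le k\le n^{1-\epsilon}$ and $G$ is $(k',\ell)$-anonymous: 1. for every outcome of the coin tosses, $G_1$ arises from $G$ by adding edges, and the number of added edges is at most $C\sqrt{(k-k')\ell}$ per vertex, in the following sense: at most $C\sqrt{(k-k')\ell}\cdot n$ edges are added in total, and if $\ell\le k-k'$, then moreover at most $C\sqrt{(k-k')\ell}$ of the added edges are incident to any single vertex; 2. with high probability, namely with probability at least $1-1/n$, the graph $G_1$ is $(k,\ell)$-anonymous. -/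

import Mathlib

/-- A finite simple graph is `(k, l)`-anonymous if for each vertex `v` there is a set `U` of at
least `k` vertices, not containing `v`, each of which shares at least `l` neighbours with `v`. -/
def IsAnonymous {V : Type*} [Fintype V] (G : SimpleGraph V) (k l : ℕ) : Prop :=
  ∀ v : V, ∃ U : Finset V, v ∉ U ∧ k ≤ U.card ∧
    ∀ u ∈ U, l ≤ (G.commonNeighbors u v).ncard

/-! ### Randomized programs with a step count

A random access machine, programmed in a structured language. Its memory consists of registers
and of two-dimensional arrays, all holding natural numbers. The only arithmetic is addition and
truncated subtraction, so that `t` steps can increase the bit length of the numbers by `O(t)` only: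
unit costs are legitimate, and polynomial time means the same as for Turing machines. The only
source of randomness is the tossing of fair coins, one bit at a time. -/

/-- Expressions: constants, registers, array cells `a[i, j]`, sums and truncated differences. -/
inductive Expr : Type where
  | const (c : ℕ) : Expr
  | reg (x : ℕ) : Expr
  | cell (a : ℕ) (i j : Expr) : Expr
  | add (e f : Expr) : Expr
  | sub (e f : Expr) : Expr

/-- Programs. A test on an expression succeeds if its value is nonzero. -/
inductive Program : Type where
  | skip : Program
  /-- `x := e` -/
  | assign (x : ℕ) (e : Expr) : Program
  /-- `a[i, j] := e` -/
  | store (a : ℕ) (i j e : Expr) : Program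
  /-- toss a fair coin and put the resulting bit into register `x` -/
  | toss (x : ℕ) : Program
  | seq (p q : Program) : Program
  | branch (e : Expr) (p q : Program) : Program
  | loop (e : Expr) (p : Program) : Program

/-- The state of the machine; `coins` is the sequence of the coin tosses still to come. -/
structure MachineState : Type where
  reg : ℕ → ℕ
  arr : ℕ → ℕ → ℕ → ℕ
  coins : ℕ → Bool

/-- The value of an expression. -/
def Expr.eval (s : MachineState) : Expr → ℕ
  | .const c => c
  | .reg x => s.reg x
  | .cell a i j => s.arr a (i.eval s) (j.eval s)
  | .add e f => e.eval s + f.eval s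
  | .sub e f => e.eval s - f.eval s

/-- The number of steps for evaluating an expression: one for each operation in it. -/
def Expr.cost : Expr → ℕ
  | .const _ => 1
  | .reg _ => 1
  | .cell _ i j => i.cost + j.cost + 1
  | .add e f => e.cost + f.cost + 1
  | .sub e f => e.cost + f.cost + 1

/-- `x := c` on states. -/
def MachineState.setReg (s : MachineState) (x c : ℕ) : MachineState :=
  { s with reg := fun y => if y = x then c else s.reg y }

/-- `a[i, j] := c` on states. -/
def MachineState.setCell (s : MachineState) (a i j c : ℕ) : MachineState :=
  { s with arr := fun a₁ i₁ j₁ => if a₁ = a ∧ i₁ = i ∧ j₁ = j then c else s.arr a₁ i₁ j₁ }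

/-- Put the next coin toss into register `x` and remove it from the sequence of coins. -/
def MachineState.tossCoin (s : MachineState) (x : ℕ) : MachineState :=
  { s.setReg x (if s.coins 0 then 1 else 0) with coins := fun i => s.coins (i + 1) }

/-- `Exec p s t s₁`: started in state `s`, the program `p` halts after exactly `t` steps,
in state `s₁`. -/
inductive Exec : Program → MachineState → ℕ → MachineState → Prop where
  | skip (s : MachineState) : Exec .skip s 1 s
  | assign (s : MachineState) (x : ℕ) (e : Expr) :
      Exec (.assign x e) s (e.cost + 1) (s.setReg x (e.eval s))
  | store (s : MachineState) (a : ℕ) (i j e : Expr) :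
      Exec (.store a i j e) s (i.cost + j.cost + e.cost + 1)
        (s.setCell a (i.eval s) (j.eval s) (e.eval s))
  | toss (s : MachineState) (x : ℕ) : Exec (.toss x) s 1 (s.tossCoin x)
  | seq {p q : Program} {s s₁ s₂ : MachineState} {t₁ t₂ : ℕ} :
      Exec p s t₁ s₁ → Exec q s₁ t₂ s₂ → Exec (.seq p q) s (t₁ + t₂ + 1) s₂
  | branch_true {e : Expr} {p q : Program} {s s₁ : MachineState} {t : ℕ} :
      e.eval s ≠ 0 → Exec p s t s₁ → Exec (.branch e p q) s (e.cost + t + 1) s₁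
  | branch_false {e : Expr} {p q : Program} {s s₁ : MachineState} {t : ℕ} :
      e.eval s = 0 → Exec q s t s₁ → Exec (.branch e p q) s (e.cost + t + 1) s₁
  | loop_true {e : Expr} {p : Program} {s s₁ s₂ : MachineState} {t₁ t₂ : ℕ} :
      e.eval s ≠ 0 → Exec p s t₁ s₁ → Exec (.loop e p) s₁ t₂ s₂ →
        Exec (.loop e p) s (e.cost + t₁ + t₂ + 1) s₂
  | loop_false {e : Expr} {p : Program} {s : MachineState} :
      e.eval s = 0 → Exec (.loop e p) s (e.cost + 1) s

/-- Given the coins, a program is deterministic: running time and final state are unique. -/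
theorem Exec.deterministic {p : Program} {s s₁ s₂ : MachineState} {t₁ t₂ : ℕ}
    (h₁ : Exec p s t₁ s₁) (h₂ : Exec p s t₂ s₂) : t₁ = t₂ ∧ s₁ = s₂ := by
  induction h₁ generalizing t₂ s₂ with
  | skip s => cases h₂; exact ⟨rfl, rfl⟩
  | assign s x e => cases h₂; exact ⟨rfl, rfl⟩
  | store s a i j e => cases h₂; exact ⟨rfl, rfl⟩
  | toss s x => cases h₂; exact ⟨rfl, rfl⟩
  | seq _ _ ih ih' =>
    cases h₂ with
    | seq k k' =>
      obtain ⟨rfl, rfl⟩ := ih k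
      obtain ⟨rfl, rfl⟩ := ih' k'
      exact ⟨rfl, rfl⟩
  | branch_true h _ ih =>
    cases h₂ with
    | branch_true _ k => obtain ⟨rfl, rfl⟩ := ih k; exact ⟨rfl, rfl⟩
    | branch_false k _ => exact absurd k h
  | branch_false h _ ih =>
    cases h₂ with
    | branch_true k _ => exact absurd h k
    | branch_false _ k => obtain ⟨rfl, rfl⟩ := ih k; exact ⟨rfl, rfl⟩
  | loop_true h _ _ ih ih' =>
    cases h₂ with
    | loop_true _ k k' =>
      obtain ⟨rfl, rfl⟩ := ih k
      obtain ⟨rfl, rfl⟩ := ih' k'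
      exact ⟨rfl, rfl⟩
    | loop_false k => exact absurd k h
  | loop_false h =>
    cases h₂ with
    | loop_true k _ _ => exact absurd h k
    | loop_false _ => exact ⟨rfl, rfl⟩

open Classical in
/-- The entry of the adjacency matrix of `G` at `i, j`, and `0` outside the matrix. -/
noncomputable def adjEntry {n : ℕ} (G : SimpleGraph (Fin n)) (i j : ℕ) : ℕ :=
  if ∃ (hi : i < n) (hj : j < n), G.Adj ⟨i, hi⟩ ⟨j, hj⟩ then 1 else 0

/-- The initial state: registers `0, 1, 2, 3` hold `n, k₀, k, l`, array `0` holds the adjacency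
matrix of the graph, the rest of the memory is zero, and no coin has been tossed yet. -/
noncomputable def initialState {n : ℕ} (G : SimpleGraph (Fin n)) (k₀ k l : ℕ)
    (ω : ℕ → Bool) : MachineState where
  reg x := if x = 0 then n else if x = 1 then k₀ else if x = 2 then k else if x = 3 then l else 0
  arr a i j := if a = 0 then adjEntry G i j else 0
  coins := ω

/-- On input `(G, k₀, k, l)` and with coin tosses `ω`, the program `A` halts after exactly `t`
steps, and array `0` then holds the adjacency matrix of the graph `G₁`. -/
def Outputs (A : Program) {n : ℕ} (G : SimpleGraph (Fin n)) (k₀ k l : ℕ) (ω : ℕ → Bool)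
    (t : ℕ) (G₁ : SimpleGraph (Fin n)) : Prop :=
  ∃ s : MachineState, Exec A (initialState G k₀ k l ω) t s ∧
    ∀ i j : Fin n, s.arr 0 i j = adjEntry G₁ i j

/-- `A` is a randomized algorithm, transforming a graph on `n` vertices and three numbers into a
graph on the same vertices, that halts after at most `T n` steps whatever the coins show. -/
def RunsInTime (A : Program) (T : ℕ → ℕ) : Prop :=
  ∀ (n : ℕ) (G : SimpleGraph (Fin n)) (k₀ k l : ℕ) (ω : ℕ → Bool),
    ∃ t ≤ T n, ∃ G₁ : SimpleGraph (Fin n), Outputs A G k₀ k l ω t G₁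

open Classical in
/-- The probability that `m` independent fair coin tosses satisfy `E`, for an event `E` that does
not depend on later tosses (they are filled up with `false`). A program that halts after at most
`m` steps tosses at most `m` coins. -/
noncomputable def coinProb (m : ℕ) (E : (ℕ → Bool) → Prop) : ℝ :=
  ((Finset.univ.filter fun r : Fin m → Bool =>
    E fun i => if h : i < m then r ⟨i, h⟩ else false).card : ℝ) / 2 ^ m

/-! ### Bounded loops and table operations -/

/-! Write `m = k - k₀`, and call two vertices partners if they share at least `l` neighbours. Every
vertex has `k₀` partners, so it suffices to give `m` new ones to each client, that is, to each
vertex with fewer than `k`. The candidates for `v` are grouped by an index, and one set `S` of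
indices, common to all vertices, has to yield `m` new partners for each client.

If `m < l`, the index of a candidate is the candidate itself, and the chosen vertices become hubs,
joined to all vertices. A hub then shares with `v` all neighbours of `v` other than itself. There
are enough of them because `v` has an old partner (`l ≤ k` forces `k₀ > 0`) and because neighbours
of a vertex of degree at most `l` are not counted as candidates. About `2m` good indices per client
suffice, and `m ≤ √(m * l)`.

If `l ≤ m`, the vertices are split into blocks of between `s` and `2s` vertices, `s ≈ √(m * l)`,
each block becomes a clique, and the index of `u` from `v` is the difference of their blocks. For `c
∈ S`, one class of at least `l + 2` vertices in each block is joined to the whole block `c` steps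
further on; through this class any two vertices of the two blocks become partners. About `2m / s`
good indices per client suffice, and the classes are used in turn, according to the rank of `c` in
`S`, so that all degrees grow by `O(s)` only (`Sparse.block_bounds`).

It remains to choose `S`. A client has at most `2k` bad candidates, so all but a fraction `O(k / n)`
of the indices are good for it. By averaging (`Greedy.exists_bad_le`), some unused index is good for
all but a fraction `1 / D` of the clients that have the fewest good indices, where `D ≈ n ^ (ε /
2)`. A greedy choice therefore raises the minimum by one in at most `C = O(1 / ε)` steps, and `C *
R` indices give every client `R` good ones (`Greedy.chosen_spec`). This is deterministic: no coin is
tossed, and the result is anonymous with certainty.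

The program is a sequence of cubic-time table operations, part of it repeated `n` times. In a list
that never overwrites what was read or written before, each operation remains true as an equation
(`SingleAssignment.apply_eq`), and so the final tables are identified with the mathematical
quantities. -/

theorem Exec.seq_of_le {p q : Program} {s s₁ s₂ : MachineState} {b₁ b₂ : ℕ}
    (h₁ : ∃ t ≤ b₁, Exec p s t s₁) (h₂ : ∃ t ≤ b₂, Exec q s₁ t s₂) :
    ∃ t ≤ b₁ + b₂ + 1, Exec (.seq p q) s t s₂ := by
  obtain ⟨t, ht, h⟩ := h₁
  obtain ⟨t', ht', h'⟩ := h₂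
  exact ⟨_, by omega, .seq h h'⟩

/-- `for x := 0, …, n - 1 do p`, where `n` is the content of register `0`. -/
def Program.forLoop (x : ℕ) (p : Program) : Program :=
  .seq (.assign x (.const 0))
    (.loop (.sub (.reg 0) (.reg x)) (.seq p (.assign x (.add (.reg x) (.const 1)))))

/-- Induction on the number `j` of remaining passes. The invariant is required of the state whose
counter has already been raised, so it serves directly as the hypothesis of the next pass. The extra
`10` per pass covers the test and the increment. -/
theorem Exec.forLoop_aux {x n b : ℕ} {p : Program} (hx : x ≠ 0) (I : ℕ → MachineState → Prop)
    (hp : ∀ i < n, ∀ s : MachineState, s.reg 0 = n → s.reg x = i → I i s →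
      ∃ s', (∃ t ≤ b, Exec p s t s') ∧ s'.reg 0 = n ∧ s'.reg x = i ∧ I (i + 1) (s'.setReg x (i + 1)))
    (j : ℕ) : ∀ i s, i + j = n → s.reg 0 = n → s.reg x = i → I i s →
      ∃ s', (∃ t ≤ j * (b + 10) + 4, Exec (.loop (.sub (.reg 0) (.reg x))
        (.seq p (.assign x (.add (.reg x) (.const 1))))) s t s') ∧ s'.reg 0 = n ∧ I n s' := by
  induction j with
  | zero =>
    intro i s hi h0 hxi hI
    obtain rfl : i = n := by omega
    refine ⟨s, ⟨_, ?_, .loop_false ?_⟩, h0, hI⟩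
    · simp [Expr.cost]
    · simp [Expr.eval, h0, hxi]
  | succ j ih =>
    intro i s hi h0 hxi hI
    obtain ⟨s', ⟨t, ht, he⟩, h0', hx', hI'⟩ := hp i (by omega) s h0 hxi hI
    have hassign := Exec.assign s' x (.add (.reg x) (.const 1))
    simp only [Expr.eval, hx'] at hassign
    obtain ⟨s'', ⟨t', ht', he'⟩, h0'', hI''⟩ := ih (i + 1) (s'.setReg x (i + 1)) (by omega)
      (by simp [MachineState.setReg, hx.symm, h0']) (by simp [MachineState.setReg]) hI'
    refine ⟨s'', ⟨_, ?_, .loop_true ?_ (.seq he hassign) he'⟩, h0'', hI''⟩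
    · simp only [Expr.cost]
      rw [Nat.succ_mul]
      omega
    · simp only [Expr.eval, h0, hxi]
      omega

theorem Exec.forLoop {x n b : ℕ} {p : Program} (hx : x ≠ 0) (I : ℕ → MachineState → Prop)
    (hp : ∀ i < n, ∀ s : MachineState, s.reg 0 = n → s.reg x = i → I i s →
      ∃ s', (∃ t ≤ b, Exec p s t s') ∧ s'.reg 0 = n ∧ s'.reg x = i ∧ I (i + 1) (s'.setReg x (i + 1)))
    {s : MachineState} (h0 : s.reg 0 = n) (hI : I 0 (s.setReg x 0)) :
    ∃ s', (∃ t ≤ n * (b + 10) + 10, Exec (p.forLoop x) s t s') ∧ s'.reg 0 = n ∧ I n s' := by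
  obtain ⟨s', ⟨t, ht, he⟩, h⟩ := Exec.forLoop_aux hx I hp n 0 (s.setReg x 0) (by omega)
    (by simp [MachineState.setReg, hx.symm, h0]) (by simp [MachineState.setReg]) hI
  refine ⟨s', ⟨_, ?_, .seq (.assign s x (.const 0)) he⟩, h⟩
  simp only [Expr.cost]
  omega

/-- The arrays that occur in an expression. -/
def Expr.arrays : Expr → List ℕ
  | .const _ => []
  | .reg _ => []
  | .cell a i j => a :: (i.arrays ++ j.arrays)
  | .add e f => e.arrays ++ f.arrays
  | .sub e f => e.arrays ++ f.arrays

/-- All registers that occur in the expression are among `0, …, 6`. -/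
def Expr.Small : Expr → Bool
  | .const _ => true
  | .reg x => x < 7
  | .cell _ i j => i.Small && j.Small
  | .add e f => e.Small && f.Small
  | .sub e f => e.Small && f.Small

theorem Expr.eval_congr {s s' : MachineState} {e : Expr} (he : e.Small)
    (hr : ∀ x < 7, s.reg x = s'.reg x) (ha : ∀ a ∈ e.arrays, s.arr a = s'.arr a) :
    e.eval s = e.eval s' := by
  induction e with
  | const c => rfl
  | reg x => exact hr x (by simpa [Expr.Small] using he)
  | cell a i j hi hj =>
    simp only [Expr.Small, Bool.and_eq_true, Expr.arrays, List.mem_cons, List.mem_append] at he ha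
    simp only [Expr.eval]
    rw [hi he.1 (fun b hb => ha b (by tauto)), hj he.2 (fun b hb => ha b (by tauto)), ha a (by tauto)]
  | add e f hi hj =>
    simp only [Expr.Small, Bool.and_eq_true, Expr.arrays, List.mem_append] at he ha
    simp only [Expr.eval]
    rw [hi he.1 (fun b hb => ha b (by tauto)), hj he.2 (fun b hb => ha b (by tauto))]
  | sub e f hi hj =>
    simp only [Expr.Small, Bool.and_eq_true, Expr.arrays, List.mem_append] at he ha
    simp only [Expr.eval]
    rw [hi he.1 (fun b hb => ha b (by tauto)), hj he.2 (fun b hb => ha b (by tauto))]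

/-- Two-dimensional arrays, indexed by natural numbers. -/
abbrev Arrays : Type := ℕ → ℕ → ℕ → ℕ

/-- The state in which an expression is evaluated: registers `0` to `3` hold the parameters,
registers `4`, `5`, `6` hold `x`, `y`, `z`. -/
def evalState (ρ : ℕ → ℕ) (F : Arrays) (x y z : ℕ) : MachineState where
  reg i := if i = 4 then x else if i = 5 then y else if i = 6 then z else ρ i
  arr := F
  coins _ := false

/-- The operation `target[x, y] := ∑ z, if guard x y z then value x y z else 0`. -/
structure TableOp : Type where
  target : ℕ
  guard : Expr
  value : Expr

/-- The new value of `target[x, y]`. -/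
def TableOp.entry (o : TableOp) (ρ : ℕ → ℕ) (F : Arrays) (x y : ℕ) : ℕ :=
  ∑ z ∈ Finset.range (ρ 0),
    if o.guard.eval (evalState ρ F x y z) ≠ 0 then o.value.eval (evalState ρ F x y z) else 0

/-- The effect of a table operation on the arrays. -/
def TableOp.apply (o : TableOp) (ρ : ℕ → ℕ) (F : Arrays) : Arrays := fun a x y =>
  if a = o.target ∧ x < ρ 0 ∧ y < ρ 0 then o.entry ρ F x y else F a x y

def TableOp.arrays (o : TableOp) : List ℕ := o.guard.arrays ++ o.value.arrays

/-- The operation reads registers `0` to `6` only and does not read its target. -/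
def TableOp.Valid (o : TableOp) : Bool :=
  o.guard.Small && o.value.Small && !(o.arrays.contains o.target)

/-- The program that performs a table operation. -/
def TableOp.program (o : TableOp) : Program :=
  .forLoop 4 (.forLoop 5 (.seq (.store o.target (.reg 4) (.reg 5) (.const 0))
    (.forLoop 6 (.branch o.guard
      (.store o.target (.reg 4) (.reg 5) (.add (.cell o.target (.reg 4) (.reg 5)) o.value)) .skip))))

/-- The registers other than the loop counters `4, …, 7` hold what `ρ` says. -/
def MachineState.Agrees (s : MachineState) (ρ : ℕ → ℕ) : Prop :=
  ∀ x, (x < 4 ∨ 7 < x) → s.reg x = ρ x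

/-- While the operation is running, only the target may differ from the initial arrays `F`, and
guard and value do not read it. -/
theorem TableOp.value_congr {o : TableOp} (ho : o.Valid) {ρ : ℕ → ℕ} {F : Arrays} {x y z : ℕ}
    {s : MachineState} (hs : s.Agrees ρ) (h4 : s.reg 4 = x) (h5 : s.reg 5 = y) (h6 : s.reg 6 = z)
    (ha : ∀ a ≠ o.target, s.arr a = F a) :
    o.guard.eval s = o.guard.eval (evalState ρ F x y z) ∧
      o.value.eval s = o.value.eval (evalState ρ F x y z) := by
  simp only [TableOp.Valid, TableOp.arrays, Bool.and_eq_true, Bool.not_eq_true',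
    ← Bool.not_eq_true, List.contains_iff_mem, List.mem_append, not_or] at ho
  have hr : ∀ i < 7, s.reg i = (evalState ρ F x y z).reg i := by
    intro i hi
    simp only [evalState]
    split_ifs with h h' h''
    · rw [h, h4]
    · rw [h', h5]
    · rw [h'', h6]
    · exact hs i (by omega)
  exact ⟨Expr.eval_congr ho.1.1 hr fun a h => ha a (by rintro rfl; exact ho.2.1 h),
    Expr.eval_congr ho.1.2 hr fun a h => ha a (by rintro rfl; exact ho.2.2 h)⟩

/-- The sums can be accumulated in place, since every guard and value is evaluated as if the target
had not changed. Register `7` is preserved because it counts the passes of an outer loop. -/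
theorem TableOp.exec (o : TableOp) (ho : o.Valid) : ∃ K : ℕ, ∀ (ρ : ℕ → ℕ) (s : MachineState),
    s.Agrees ρ → ∃ s', (∃ t ≤ K * (ρ 0 + 1) ^ 3, Exec o.program s t s') ∧ s'.Agrees ρ ∧
      s'.reg 7 = s.reg 7 ∧ s'.arr = o.apply ρ s.arr := by
  set c := o.guard.cost + o.value.cost + 20 with hc
  refine ⟨c + 60, fun ρ s hs => ?_⟩
  set n := ρ 0 with hn
  set F := s.arr with hF
  -- the arrays at the beginning of the innermost loop for `x, y`
  let H : ℕ → ℕ → ℕ → Arrays := fun x y w a i j =>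
    if a = o.target then
      if i < x ∧ j < n ∨ i = x ∧ j < y then o.entry ρ F i j
      else if i = x ∧ j = y then w else F a i j
    else F a i j
  let W : ℕ → ℕ → ℕ → ℕ := fun x y z' => ∑ z ∈ Finset.range z',
    if o.guard.eval (evalState ρ F x y z) ≠ 0 then o.value.eval (evalState ρ F x y z) else 0
  have inner : ∀ x y (s₁ : MachineState), s₁.Agrees ρ → s₁.reg 4 = x → s₁.reg 5 = y →
      s₁.reg 7 = s.reg 7 → s₁.arr = H x y 0 →
      ∃ s', (∃ t ≤ n * (c + 10) + 10, Exec (.forLoop 6 (.branch o.guard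
        (.store o.target (.reg 4) (.reg 5) (.add (.cell o.target (.reg 4) (.reg 5)) o.value)) .skip))
        s₁ t s') ∧ s'.Agrees ρ ∧ s'.reg 4 = x ∧ s'.reg 5 = y ∧ s'.reg 7 = s.reg 7 ∧
        s'.arr = H x y (W x y n) := by
    intro x y s₁ h₁ h4 h5 h7 ha
    obtain ⟨s', he, -, h⟩ := Exec.forLoop (x := 6) (n := n) (b := c) (by norm_num)
      (fun z s' => s'.Agrees ρ ∧ s'.reg 4 = x ∧ s'.reg 5 = y ∧ s'.reg 7 = s.reg 7 ∧
        s'.arr = H x y (W x y z))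
      (p := .branch o.guard (.store o.target (.reg 4) (.reg 5)
        (.add (.cell o.target (.reg 4) (.reg 5)) o.value)) .skip) (by
          rintro z hz s₂ h0 h6 ⟨h₂, h4, h5, h7, ha⟩
          obtain ⟨hg, hv⟩ := o.value_congr ho h₂ h4 h5 h6 (F := F) (by
            intro a hne
            rw [ha]
            funext i j
            simp [H, hne])
          by_cases hg0 : o.guard.eval s₂ = 0
          · refine ⟨s₂, ⟨_, ?_, .branch_false hg0 (.skip s₂)⟩, h0, h6, ?_, ?_, ?_, ?_, ?_⟩
            · omega
            · intro i hi
              simp only [MachineState.setReg]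
              rw [if_neg (by omega)]
              exact h₂ i hi
            · simpa [MachineState.setReg] using h4
            · simpa [MachineState.setReg] using h5
            · simpa [MachineState.setReg] using h7
            · have : W x y (z + 1) = W x y z := by
                simp only [W, Finset.sum_range_succ]
                rw [← hg, hg0]
                simp
              simp only [MachineState.setReg]
              rw [this, ha]
          · refine ⟨_, ⟨_, ?_, .branch_true hg0 (.store s₂ _ _ _ _)⟩, h0, h6, ?_, ?_, ?_, ?_, ?_⟩
            · simp only [Expr.cost]
              omega
            · intro i hi
              simp only [MachineState.setReg, MachineState.setCell]
              rw [if_neg (by omega)]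
              exact h₂ i hi
            · simpa [MachineState.setReg, MachineState.setCell] using h4
            · simpa [MachineState.setReg, MachineState.setCell] using h5
            · simpa [MachineState.setReg, MachineState.setCell] using h7
            · have : W x y (z + 1) = W x y z + o.value.eval s₂ := by
                simp only [W, Finset.sum_range_succ]
                rw [← hg, if_pos hg0, ← hv]
              simp only [MachineState.setReg, MachineState.setCell, Expr.eval, h4, h5]
              rw [this, ha]
              funext a i j
              by_cases h1 : a = o.target
              · by_cases h2 : i = x
                · by_cases h3 : j = y
                  · simp [H, h1, h2, h3]
                  · simp [H, h1, h2, h3]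
                · simp [H, h1, h2]
              · simp [H, h1]) (s := s₁) (h₁ 0 (by omega))
      (by
          refine ⟨?_, ?_, ?_, ?_, ?_⟩
          · intro i hi
            simp only [MachineState.setReg]
            rw [if_neg (by omega)]
            exact h₁ i hi
          · simpa [MachineState.setReg] using h4
          · simpa [MachineState.setReg] using h5
          · simpa [MachineState.setReg] using h7
          · simpa [MachineState.setReg, W] using ha)
    exact ⟨s', he, h⟩
  -- The cells before `(x, y)` in row order are final and the others untouched; a finished row `H' x
  -- n` is the same as `H' (x + 1) 0`.
  let H' : ℕ → ℕ → Arrays := fun x y a i j =>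
    if a = o.target ∧ (i < x ∧ j < n ∨ i = x ∧ j < y) then o.entry ρ F i j else F a i j
  have middle : ∀ x (s₁ : MachineState), s₁.Agrees ρ → s₁.reg 4 = x →
      s₁.reg 7 = s.reg 7 → s₁.arr = H' x 0 →
      ∃ s', (∃ t ≤ n * ((n * (c + 10) + 20) + 10) + 10, Exec (.forLoop 5 (.seq
        (.store o.target (.reg 4) (.reg 5) (.const 0)) (.forLoop 6 (.branch o.guard
        (.store o.target (.reg 4) (.reg 5) (.add (.cell o.target (.reg 4) (.reg 5)) o.value))
        .skip)))) s₁ t s') ∧ s'.Agrees ρ ∧ s'.reg 4 = x ∧ s'.reg 7 = s.reg 7 ∧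
        s'.arr = H' x n := by
    intro x s₁ h₁ h4 h7 ha
    obtain ⟨s', he, -, h⟩ := Exec.forLoop (x := 5) (n := n) (b := n * (c + 10) + 20) (by norm_num)
      (fun y s' => s'.Agrees ρ ∧ s'.reg 4 = x ∧ s'.reg 7 = s.reg 7 ∧ s'.arr = H' x y)
      (p := .seq (.store o.target (.reg 4) (.reg 5) (.const 0)) (.forLoop 6 (.branch o.guard
        (.store o.target (.reg 4) (.reg 5) (.add (.cell o.target (.reg 4) (.reg 5)) o.value))
        .skip))) (by
          rintro y hy s₂ h0 h5 ⟨h₂, h4, h7, ha⟩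
          obtain ⟨s', ⟨t, ht, he⟩, h', h4', h5', h7', ha'⟩ := inner x y
            (s₂.setCell o.target x y 0) h₂ h4 h5 h7 (by
              simp only [MachineState.setCell]
              rw [ha]
              funext a i j
              by_cases h1 : a = o.target
              · by_cases h2 : i = x
                · by_cases h3 : j = y
                  · simp [H, H', h1, h2, h3]
                  · simp [H, H', h1, h2, h3]
                · simp [H, H', h1, h2]
              · simp [H, H', h1])
          have hst := Exec.store s₂ o.target (.reg 4) (.reg 5) (.const 0)
          simp only [Expr.eval, h4, h5, Expr.cost] at hst
          refine ⟨s', ⟨_, ?_, .seq hst he⟩, h' 0 (by omega), h5', ?_, ?_, ?_, ?_⟩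
          · omega
          · intro i hi
            simp only [MachineState.setReg]
            rw [if_neg (by omega)]
            exact h' i hi
          · simpa [MachineState.setReg] using h4'
          · simpa [MachineState.setReg] using h7'
          · simp only [MachineState.setReg, ha']
            funext a i j
            by_cases h1 : a = o.target
            · by_cases h2 : i = x
              · rcases lt_trichotomy j y with h3 | h3 | h3
                · simp [H, H', h1, h2, h3, h3.trans (Nat.lt_succ_self y)]
                · simp [H, H', h1, h2, h3, W, TableOp.entry, hn]
                · simp [H, H', h1, h2, h3.not_gt, h3.ne', (Nat.succ_le_of_lt h3).not_gt]
              · simp [H, H', h1, h2]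
            · simp [H, H', h1]) (s := s₁) (h₁ 0 (by omega)) (by
          refine ⟨?_, ?_, ?_, ?_⟩
          · intro i hi
            simp only [MachineState.setReg]
            rw [if_neg (by omega)]
            exact h₁ i hi
          · simpa [MachineState.setReg] using h4
          · simpa [MachineState.setReg] using h7
          · simpa [MachineState.setReg] using ha)
    exact ⟨s', he, h⟩
  obtain ⟨s', ⟨t, ht, he⟩, -, h', h7', ha'⟩ := Exec.forLoop (x := 4) (n := n)
    (b := n * ((n * (c + 10) + 20) + 10) + 10) (by norm_num)
    (fun x s' => s'.Agrees ρ ∧ s'.reg 7 = s.reg 7 ∧ s'.arr = H' x 0)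
    (p := .forLoop 5 (.seq (.store o.target (.reg 4) (.reg 5) (.const 0)) (.forLoop 6
      (.branch o.guard (.store o.target (.reg 4) (.reg 5)
        (.add (.cell o.target (.reg 4) (.reg 5)) o.value)) .skip)))) (by
      rintro x hx s₂ h0 h4 ⟨h₂, h7, ha⟩
      obtain ⟨s', he, h', h4', h7', ha'⟩ := middle x s₂ h₂ h4 h7 ha
      refine ⟨s', he, h' 0 (by omega), h4', ?_, ?_, ?_⟩
      · intro i hi
        simp only [MachineState.setReg]
        rw [if_neg (by omega)]
        exact h' i hi
      · simpa [MachineState.setReg] using h7'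
      · simp only [MachineState.setReg, ha']
        funext a i j
        have : i < x ∧ j < n ∨ i = x ∧ j < n ↔ i < x + 1 ∧ j < n ∨ i = x + 1 ∧ j < 0 := by omega
        simp only [H', this])
    (s := s) (hs 0 (by omega)) (by
      refine ⟨?_, by simp [MachineState.setReg], by simp [MachineState.setReg, H', hF]⟩
      intro i hi
      simp only [MachineState.setReg]
      rw [if_neg (by omega)]
      exact hs i hi)
  refine ⟨s', ⟨t, ht.trans ?_, he⟩, h', h7', ?_⟩
  · ring_nf
    nlinarith [Nat.zero_le (n * c), Nat.zero_le (n ^ 2 * c), Nat.zero_le c, Nat.zero_le n,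
      Nat.zero_le (n ^ 2)]
  · rw [ha']
    funext a i j
    simp [H', TableOp.apply, ← hn]

/-! ### Sequences of table operations -/

/-- The effect of a list of table operations. -/
def applyOps (ρ : ℕ → ℕ) (L : List TableOp) (F : Arrays) : Arrays :=
  L.foldl (fun F o => o.apply ρ F) F

/-- The program that performs a list of table operations. -/
def opsProgram : List TableOp → Program
  | [] => .skip
  | o :: L => .seq o.program (opsProgram L)

theorem opsProgram_exec (L : List TableOp) (hL : ∀ o ∈ L, o.Valid) :
    ∃ K : ℕ, ∀ (ρ : ℕ → ℕ) (s : MachineState), s.Agrees ρ →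
      ∃ s', (∃ t ≤ K * (ρ 0 + 1) ^ 3, Exec (opsProgram L) s t s') ∧ s'.Agrees ρ ∧
        s'.reg 7 = s.reg 7 ∧ s'.arr = applyOps ρ L s.arr := by
  induction L with
  | nil =>
    refine ⟨1, fun ρ s hs => ⟨s, ⟨1, ?_, .skip s⟩, hs, rfl, rfl⟩⟩
    have := Nat.one_le_pow 3 (ρ 0 + 1) (by omega)
    omega
  | cons o L ih =>
    obtain ⟨K₁, h₁⟩ := o.exec (hL o (by simp))
    obtain ⟨K₂, h₂⟩ := ih fun o' h => hL o' (by simp [h])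
    refine ⟨K₁ + K₂ + 1, fun ρ s hs => ?_⟩
    obtain ⟨s₁, he₁, hs₁, h7₁, ha₁⟩ := h₁ ρ s hs
    obtain ⟨s₂, he₂, hs₂, h7₂, ha₂⟩ := h₂ ρ s₁ hs₁
    obtain ⟨t, ht, he⟩ := Exec.seq_of_le he₁ he₂
    refine ⟨s₂, ⟨t, ht.trans ?_, he⟩, hs₂, h7₂.trans h7₁, ?_⟩
    · have := Nat.one_le_pow 3 (ρ 0 + 1) (by omega)
      rw [add_mul, add_mul, one_mul]
      omega
    · rw [ha₂, ha₁]
      rfl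

/-- Perform `pre`, then `n` times `body`, then `post`. -/
def loopProgram (pre body post : List TableOp) : Program :=
  .seq (opsProgram pre) (.seq (.forLoop 7 (opsProgram body)) (opsProgram post))

/-- Each list takes cubic time and `body` is performed `n` times, whence the fourth power. -/
theorem loopProgram_exec (pre body post : List TableOp) (h₁ : ∀ o ∈ pre, o.Valid)
    (h₂ : ∀ o ∈ body, o.Valid) (h₃ : ∀ o ∈ post, o.Valid) :
    ∃ K : ℕ, ∀ (ρ : ℕ → ℕ) (s : MachineState), s.Agrees ρ →
      ∃ s', (∃ t ≤ K * (ρ 0 + 1) ^ 4, Exec (loopProgram pre body post) s t s') ∧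
        s'.arr = applyOps ρ post ((applyOps ρ body)^[ρ 0] (applyOps ρ pre s.arr)) := by
  obtain ⟨K₁, h₁⟩ := opsProgram_exec pre h₁
  obtain ⟨K₂, h₂⟩ := opsProgram_exec body h₂
  obtain ⟨K₃, h₃⟩ := opsProgram_exec post h₃
  refine ⟨K₁ + K₂ + K₃ + 30, fun ρ s hs => ?_⟩
  obtain ⟨s₁, he₁, hs₁, -, ha₁⟩ := h₁ ρ s hs
  obtain ⟨s₂, he₂, -, hs₂, ha₂⟩ := Exec.forLoop (x := 7) (n := ρ 0) (by norm_num)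
    (fun i s' => s'.Agrees ρ ∧ s'.arr = (applyOps ρ body)^[i] s₁.arr) (p := opsProgram body)
    (b := K₂ * (ρ 0 + 1) ^ 3) (by
      rintro i - s' - h7 ⟨hs', ha'⟩
      obtain ⟨s'', he, hs'', h7', ha''⟩ := h₂ ρ s' hs'
      refine ⟨s'', he, hs'' 0 (by omega), by omega, ?_, ?_⟩
      · intro j hj
        simp only [MachineState.setReg]
        rw [if_neg (by omega)]
        exact hs'' j hj
      · simp only [MachineState.setReg, Function.iterate_succ_apply']
        rw [ha'', ha'])
    (s := s₁) (hs₁ 0 (by omega)) (by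
      refine ⟨?_, by simp [MachineState.setReg]⟩
      intro j hj
      simp only [MachineState.setReg]
      rw [if_neg (by omega)]
      exact hs₁ j hj)
  obtain ⟨s₃, he₃, -, -, ha₃⟩ := h₃ ρ s₂ hs₂
  obtain ⟨t, ht, he⟩ := Exec.seq_of_le he₁ (Exec.seq_of_le he₂ he₃)
  refine ⟨s₃, ⟨t, ht.trans ?_, he⟩, by rw [ha₃, ha₂, ha₁]⟩
  generalize ρ 0 = n
  have e1 : (n + 1) ^ 4 = n * (n + 1) ^ 3 + (n + 1) ^ 3 := by ring
  have e2 : n + 1 ≤ (n + 1) ^ 3 := Nat.le_self_pow (by norm_num) _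
  rw [e1]
  generalize (n + 1) ^ 3 = N at *
  ring_nf
  nlinarith [Nat.zero_le (n * N), Nat.zero_le (n * N * K₁), Nat.zero_le (n * N * K₃),
    Nat.zero_le (N * K₂)]

/-- No operation of the list overwrites its own input or anything that an earlier operation has
read or written. -/
def SingleAssignment : List TableOp → Bool
  | [] => true
  | o :: L => o.Valid && (o.target :: o.arrays).all (fun a => !((L.map (·.target)).contains a)) &&
      SingleAssignment L

theorem SingleAssignment.valid {L : List TableOp} (hL : SingleAssignment L) : ∀ o ∈ L, o.Valid := by
  induction L with
  | nil => simp
  | cons o L ih =>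
    simp only [SingleAssignment, Bool.and_eq_true] at hL
    intro o' ho'
    rcases List.mem_cons.1 ho' with rfl | h
    · exact hL.1.1
    · exact ih hL.2 o' h

theorem applyOps_of_notMem {ρ : ℕ → ℕ} {L : List TableOp} {F : Arrays} {a : ℕ}
    (ha : a ∉ L.map (·.target)) : applyOps ρ L F a = F a := by
  induction L generalizing F with
  | nil => rfl
  | cons o L ih =>
    simp only [List.map_cons, List.mem_cons, not_or] at ha
    have : applyOps ρ (o :: L) F = applyOps ρ L (o.apply ρ F) := rfl
    rw [this, ih ha.2]
    funext x y
    simp [TableOp.apply, ha.1]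

theorem TableOp.entry_congr {o : TableOp} (ho : o.Valid) {ρ : ℕ → ℕ} {F F' : Arrays} {x y : ℕ}
    (h : ∀ a ∈ o.arrays, F a = F' a) : o.entry ρ F x y = o.entry ρ F' x y := by
  simp only [TableOp.Valid, Bool.and_eq_true] at ho
  simp only [TableOp.arrays, List.mem_append] at h
  refine Finset.sum_congr rfl fun z _ => ?_
  rw [Expr.eval_congr (s := evalState ρ F x y z) (s' := evalState ρ F' x y z) ho.1.1
      (fun _ _ => rfl) fun a ha => h a (.inl ha),
    Expr.eval_congr (s := evalState ρ F x y z) (s' := evalState ρ F' x y z) ho.1.2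
      (fun _ _ => rfl) fun a ha => h a (.inr ha)]

/-- After a single assignment list of operations, each operation is an equation that holds. -/
theorem SingleAssignment.apply_eq {ρ : ℕ → ℕ} {L : List TableOp} (hL : SingleAssignment L)
    (F : Arrays) {o : TableOp} (ho : o ∈ L) {x y : ℕ} (hx : x < ρ 0) (hy : y < ρ 0) :
    applyOps ρ L F o.target x y = o.entry ρ (applyOps ρ L F) x y := by
  induction L generalizing F with
  | nil => simp at ho
  | cons o' L ih =>
    simp only [SingleAssignment, Bool.and_eq_true, List.all_eq_true, Bool.not_eq_true',
      ← Bool.not_eq_true, List.contains_iff_mem] at hL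
    have hstep : applyOps ρ (o' :: L) F = applyOps ρ L (o'.apply ρ F) := rfl
    rw [hstep]
    rcases List.mem_cons.1 ho with rfl | h
    · have hval := hL.1.1
      rw [applyOps_of_notMem (hL.1.2 _ (by simp))]
      have : o.apply ρ F o.target x y = o.entry ρ F x y := by simp [TableOp.apply, hx, hy]
      rw [this]
      refine TableOp.entry_congr hval fun a ha => ?_
      rw [applyOps_of_notMem (hL.1.2 a (by simp [ha]))]
      have hne : a ≠ o.target := by
        rintro rfl
        simp only [TableOp.Valid, Bool.and_eq_true, Bool.not_eq_true', ← Bool.not_eq_true,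
          List.contains_iff_mem] at hval
        exact hval.2 ha
      funext i j
      simp [TableOp.apply, hne]
    · exact ih hL.2 _ h

/-! ### Tests as expressions -/

namespace Expr

/-- Truth means a nonzero value. Truncated subtraction suffices: `1 - e` negates, and `e - f`
vanishes exactly when `e ≤ f`. -/
def neg (e : Expr) : Expr := .sub (.const 1) e
def conj (e f : Expr) : Expr := .sub (.const 1) (.add (neg e) (neg f))
def disj (e f : Expr) : Expr := .add e f
def leq (e f : Expr) : Expr := neg (.sub e f)
def less (e f : Expr) : Expr := .sub f e
def eql (e f : Expr) : Expr := neg (.add (.sub e f) (.sub f e))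

variable {s : MachineState} {e f : Expr}

theorem eval_neg : (neg e).eval s ≠ 0 ↔ e.eval s = 0 := by
  simp only [neg, eval]; omega
theorem eval_conj : (conj e f).eval s ≠ 0 ↔ e.eval s ≠ 0 ∧ f.eval s ≠ 0 := by
  simp only [conj, neg, eval]; omega
theorem eval_disj : (disj e f).eval s ≠ 0 ↔ e.eval s ≠ 0 ∨ f.eval s ≠ 0 := by
  simp only [disj, eval]; omega
theorem eval_leq : (leq e f).eval s ≠ 0 ↔ e.eval s ≤ f.eval s := by
  simp only [leq, neg, eval]; omega
theorem eval_less : (less e f).eval s ≠ 0 ↔ e.eval s < f.eval s := by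
  simp only [less, eval]; omega
theorem eval_eql : (eql e f).eval s ≠ 0 ↔ e.eval s = f.eval s := by
  simp only [eql, neg, eval]; omega

end Expr

/-! ### The algorithm -/

namespace Anonymizer

open Expr

def X : Expr := .reg 4
def Y : Expr := .reg 5
def Z : Expr := .reg 6
-- Vectors and single numbers are also stored as full tables, with entries that do not depend on the
-- unused indices; hence reading column `0` or cell `0, 0` is enough.
def row (a : ℕ) (i : Expr) : Expr := .cell a i (.const 0)
def scalar (a : ℕ) : Expr := .cell a (.const 0) (.const 0)
def need : Expr := .sub (.reg 2) (.reg 1)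
def hub : Expr := less need (.reg 3)
def sizeExpr : Expr := .add (scalar 8) (.const 2)
def residue (i : Expr) : Expr := .sub i (.cell 7 (row 10 i) (scalar 9))
def good (v c : Expr) : Expr := leq (scalar 14) (.add (.cell 13 v c) (.cell 13 v c))
def client (v : Expr) : Expr := less (row 5 v) (.reg 2)
def count (a : ℕ) (g : Expr) : TableOp := ⟨a, g, .const 1⟩
def point (a : ℕ) (g : Expr) : TableOp := ⟨a, conj (eql Z X) g, .const 1⟩

/-- Tables `1` to `16` depend on the input only, table `20` marks the chosen indices, `21` to `26`
are recomputed in each round, and `30` to `34` describe the new edges. -/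
def opCommon : TableOp := count 1 (conj (.cell 0 X Z) (.cell 0 Z Y))
def opDegree : TableOp := count 2 (.cell 0 X Z)
def opPartner : TableOp := point 3 (conj (neg (eql X Y)) (leq (.reg 3) (.cell 1 X Y)))
def opBad : TableOp := point 4 (disj (eql X Y) (disj (.cell 3 X Y)
  (conj (.cell 0 X Y) (leq (row 2 X) (.reg 3)))))
def opPartners : TableOp := count 5 (.cell 3 X Z)
-- Multiplication by repeated addition. The later operations look products up in this table, and
-- obtain square roots and quotients by counting; this works as long as the factors are below `n`.
def opMul : TableOp := ⟨7, less Z X, Y⟩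
def opRoot : TableOp := count 8 (less (.cell 7 Z Z) (.cell 7 need (.reg 3)))
def opBlocks : TableOp := count 9 (leq (.add (.cell 7 Z sizeExpr) sizeExpr) (.reg 0))
def opQuotient : TableOp := count 10 (leq (.add (.cell 7 Z (scalar 9)) (scalar 9)) X)
-- For admissible parameters a single `z` passes the guard, and the sum returns it.
def opShift : TableOp := ⟨12, disj (conj hub (eql Z Y)) (conj (neg hub) (conj (less Z (scalar 9))
  (disj (eql (.add (residue X) Z) (residue Y))
    (eql (.add (residue X) Z) (.add (residue Y) (scalar 9)))))), Z⟩
def opGain : TableOp := count 13 (conj (neg (.cell 4 X Z)) (eql (.cell 12 X Z) Y))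
def opWidth : TableOp := count 14 (disj (conj hub (less Z (.const 1)))
  (conj (neg hub) (less Z sizeExpr)))
def opClasses : TableOp := count 15 (disj (conj hub (less Z (.const 1)))
  (conj (neg hub) (leq (.add (.cell 7 Z (.add (.reg 3) (.const 2))) (.add (.reg 3) (.const 2)))
    sizeExpr)))
def opRounds : TableOp := count 16 (less (.cell 7 Z (scalar 14)) (.add need need))

def pre : List TableOp := [opCommon, opDegree, opPartner, opBad, opPartners, opMul, opRoot, opBlocks,
  opQuotient, opShift, opGain, opWidth, opClasses, opRounds]

def opCount : TableOp := count 21 (conj (row 20 Z) (good X Z))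
def opBehind : TableOp := count 22 (conj (client Z) (leq (row 21 Z) X))
def opLevel : TableOp := count 23 (neg (row 22 Z))
def opScore : TableOp := count 24 (conj (client Z) (conj (leq (row 21 Z) (scalar 23))
  (conj (good Z X) (neg (row 20 X)))))
def opBeaten : TableOp := count 25 (disj (less (row 24 X) (row 24 Z))
  (conj (eql (row 24 X) (row 24 Z)) (less Z X)))
def opNext : TableOp := point 26 (disj (row 20 X) (conj (less (scalar 23) (scalar 16))
  (neg (row 25 X))))
def opCopyChosen : TableOp := point 20 (row 26 X)

/-- The operation that overwrites table `20` is kept apart, because `bodyPlan` reads that table and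
would not be a single assignment list with it. `opOutput`, which overwrites table `0`, is separated
from `postPlan` for the same reason. -/
def bodyPlan : List TableOp := [opCount, opBehind, opLevel, opScore, opBeaten, opNext]
def body : List TableOp := bodyPlan ++ [opCopyChosen]

def opRank : TableOp := count 30 (conj (less Z X) (row 20 Z))
def opRankQuotient : TableOp := count 31 (leq (.add (.cell 7 Z (scalar 15)) (scalar 15)) (row 30 X))
def opSubQuotient : TableOp := count 32 (leq (.add (.cell 7 Z (scalar 15)) (scalar 15)) (row 10 X))
def opLink : TableOp := point 33 (disj (eql (.cell 12 X Y) (.const 0))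
  (conj (row 20 (.cell 12 X Y)) (eql (.sub (row 10 X) (.cell 7 (row 32 X) (scalar 15)))
    (.sub (row 30 (.cell 12 X Y)) (.cell 7 (row 31 (.cell 12 X Y)) (scalar 15))))))
def opNew : TableOp := point 34 (disj (.cell 0 X Y) (conj (neg (eql X Y))
  (conj need (conj (.reg 3) (disj (.cell 33 X Y) (.cell 33 Y X))))))
def opOutput : TableOp := point 0 (.cell 34 X Y)

def postPlan : List TableOp := [opRank, opRankQuotient, opSubQuotient, opLink, opNew]
def post : List TableOp := postPlan ++ [opOutput]

/-- The algorithm. The usual random choice of the new partners is replaced by a greedy choice, which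
counts for each candidate the vertices that profit from it, so that no coins are needed and the
result is anonymous with certainty. -/
def program : Program := loopProgram pre body post

theorem pre_singleAssignment : SingleAssignment pre := by decide
theorem bodyPlan_singleAssignment : SingleAssignment bodyPlan := by decide
theorem postPlan_singleAssignment : SingleAssignment postPlan := by decide

theorem program_exec : ∃ K : ℕ, ∀ (ρ : ℕ → ℕ) (s : MachineState), s.Agrees ρ →
    ∃ s', (∃ t ≤ K * (ρ 0 + 1) ^ 4, Exec program s t s') ∧
      s'.arr = applyOps ρ post ((applyOps ρ body)^[ρ 0] (applyOps ρ pre s.arr)) :=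
  loopProgram_exec pre body post (SingleAssignment.valid pre_singleAssignment)
    (by decide) (by decide)

end Anonymizer

/-! ### Greedy covering -/

/-- For a predicate on `ℕ` that is inherited by smaller numbers, the number of `z < n` with `P z` is
the threshold of `P` below `n`. -/
theorem lt_card_filter_iff {n : ℕ} {P : ℕ → Prop} [DecidablePred P]
    (hP : ∀ i j, i ≤ j → P j → P i) {z : ℕ} (hz : z < n) :
    z < ((Finset.range n).filter P).card ↔ P z := by
  constructor
  · intro h
    by_contra hz'
    have : (Finset.range n).filter P ⊆ Finset.range z := by
      intro i hi
      simp only [Finset.mem_filter, Finset.mem_range] at hi ⊢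
      by_contra hlt
      exact hz' (hP z i (by omega) hi.2)
    have := Finset.card_le_card this
    rw [Finset.card_range] at this
    omega
  · intro h
    have : Finset.range (z + 1) ⊆ (Finset.range n).filter P := by
      intro i hi
      simp only [Finset.mem_filter, Finset.mem_range] at hi ⊢
      exact ⟨by omega, hP i z (by omega) h⟩
    have := Finset.card_le_card this
    rw [Finset.card_range] at this
    omega

namespace Greedy

open Classical in
/-- The number of chosen indices that are good for `v`. -/
noncomputable def covered (n : ℕ) (good : ℕ → ℕ → Prop) (S : Finset ℕ) (v : ℕ) : ℕ :=
  ((Finset.range n).filter fun c => c ∈ S ∧ good v c).card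

open Classical in
/-- The least number of good chosen indices that a client has. -/
noncomputable def level (n : ℕ) (client : ℕ → Prop) (good : ℕ → ℕ → Prop) (S : Finset ℕ) : ℕ :=
  ((Finset.range n).filter fun z =>
    ((Finset.range n).filter fun v => client v ∧ covered n good S v ≤ z).card = 0).card

open Classical in
/-- The number of clients on the lowest level that profit from `c`. -/
noncomputable def score (n : ℕ) (client : ℕ → Prop) (good : ℕ → ℕ → Prop) (S : Finset ℕ)
    (c : ℕ) : ℕ :=
  ((Finset.range n).filter fun v => client v ∧
    covered n good S v ≤ level n client good S ∧ good v c ∧ c ∉ S).card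

open Classical in
/-- Choose one more index, one of maximal score, unless all clients have reached level `R`. -/
noncomputable def step (n R : ℕ) (client : ℕ → Prop) (good : ℕ → ℕ → Prop) (S : Finset ℕ) :
    Finset ℕ :=
  (Finset.range n).filter fun c => c ∈ S ∨ level n client good S < R ∧
    ((Finset.range n).filter fun z => score n client good S c < score n client good S z ∨
      score n client good S c = score n client good S z ∧ z < c).card = 0

variable {n R : ℕ} {client : ℕ → Prop} {good : ℕ → ℕ → Prop} {S : Finset ℕ}

theorem lt_level_iff {z : ℕ} (hz : z < n) :
    z < level n client good S ↔ ∀ v < n, client v → z < covered n good S v := by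
  classical
  unfold level
  rw [lt_card_filter_iff _ hz]
  · simp only [Finset.card_eq_zero, Finset.filter_eq_empty_iff, Finset.mem_range, not_and, not_le]
  · intro i j hij
    simp only [Finset.card_eq_zero, Finset.filter_eq_empty_iff, Finset.mem_range, not_and, not_le]
    intro h v hv hc
    exact hij.trans_lt (h hv hc)

theorem le_covered {v : ℕ} (hv : v < n) (hc : client v) (hn : level n client good S < n) :
    level n client good S ≤ covered n good S v := by
  by_contra h
  push Not at h
  have := (lt_level_iff (h.trans hn)).1 h v hv hc
  omega

theorem step_of_le (hS : S ⊆ Finset.range n) (h : R ≤ level n client good S) :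
    step n R client good S = S := by
  classical
  ext c
  simp only [step, Finset.mem_filter, Finset.mem_range, h.not_gt, false_and, or_false]
  exact ⟨fun h => h.2, fun h => ⟨Finset.mem_range.1 (hS h), h⟩⟩

/-- Ties are broken by the number of the index, so the least index of maximal score is the only one
that is not beaten. -/
theorem exists_step_eq_insert (hn : 0 < n) (hS : S ⊆ Finset.range n)
    (h : level n client good S < R) :
    ∃ c < n, step n R client good S = insert c S ∧
      ∀ z < n, score n client good S z ≤ score n client good S c := by
  classical
  obtain ⟨c₀, hc₀, hmax₀⟩ := Finset.exists_max_image (Finset.range n) (score n client good S)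
    ⟨0, Finset.mem_range.2 hn⟩
  have hex : ∃ c, c < n ∧ ∀ z < n, score n client good S z ≤ score n client good S c :=
    ⟨c₀, Finset.mem_range.1 hc₀, fun z hz => hmax₀ z (Finset.mem_range.2 hz)⟩
  let c := Nat.find hex
  obtain ⟨hc, hmax⟩ : c < n ∧ ∀ z < n, score n client good S z ≤ score n client good S c :=
    Nat.find_spec hex
  refine ⟨c, hc, ?_, hmax⟩
  ext i
  simp only [step, Finset.mem_filter, Finset.mem_range, h, true_and, Finset.card_eq_zero,
    Finset.filter_eq_empty_iff, not_or, not_and, not_lt, Finset.mem_insert]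
  constructor
  · rintro ⟨hi, hi' | hi'⟩
    · exact .inr hi'
    · left
      have h1 : c ≤ i := by
        refine Nat.find_min' hex ⟨hi, fun z hz => (hi' hz).1⟩
      have h2 := (hi' hc).1
      have h3 := hmax i hi
      exact le_antisymm ((hi' hc).2 (le_antisymm h3 h2)) h1
  · rintro (rfl | hi)
    · refine ⟨hc, .inr fun z hz => ⟨hmax z hz, fun he => ?_⟩⟩
      exact Nat.find_min' hex ⟨hz, fun w hw => he ▸ hmax w hw⟩
    · exact ⟨Finset.mem_range.1 (hS hi), .inl hi⟩

theorem covered_mono {S' : Finset ℕ} (h : S ⊆ S') (v : ℕ) :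
    covered n good S v ≤ covered n good S' v := by
  classical
  refine Finset.card_le_card fun c hc => ?_
  simp only [Finset.mem_filter] at hc ⊢
  exact ⟨hc.1, h hc.2.1, hc.2.2⟩

theorem covered_insert {c v : ℕ} (hc : c < n) (hcS : c ∉ S) (hg : good v c) :
    covered n good S v + 1 ≤ covered n good (insert c S) v := by
  classical
  unfold covered
  have : insert c ((Finset.range n).filter fun i => i ∈ S ∧ good v i) ⊆
      (Finset.range n).filter fun i => i ∈ insert c S ∧ good v i := by
    intro i hi
    simp only [Finset.mem_filter, Finset.mem_insert] at hi ⊢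
    rcases hi with rfl | hi
    · exact ⟨Finset.mem_range.2 hc, .inl rfl, hg⟩
    · exact ⟨hi.1, .inr hi.2.1, hi.2.2⟩
  have h := Finset.card_le_card this
  rwa [Finset.card_insert_of_notMem (by simp [hcS])] at h

open Classical in
/-- The clients on the lowest level. -/
noncomputable def behind (n : ℕ) (client : ℕ → Prop) (good : ℕ → ℕ → Prop) (S : Finset ℕ)
    (r : ℕ) : Finset ℕ :=
  (Finset.range n).filter fun v => client v ∧ covered n good S v ≤ r

/-- There is an index that satisfies most of the clients, by averaging. -/
theorem exists_bad_le (U : Finset ℕ) (N D β : ℕ)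
    (hβ : ∀ v ∈ U, ∀ B : Finset ℕ, (∀ c ∈ B, c < N ∧ ¬ good v c) → B.card ≤ β)
    (hN : D * β + S.card < N) :
    ∃ c < N, c ∉ S ∧ ∀ B ⊆ U, (∀ v ∈ B, ¬ good v c) → D * B.card ≤ U.card := by
  classical
  by_contra hcon
  push Not at hcon
  let A := Finset.range N \ S
  have hA : D * β < A.card := by
    have := Finset.le_card_sdiff S (Finset.range N)
    rw [Finset.card_range] at this
    show D * β < (Finset.range N \ S).card
    omega
  let f : ℕ → ℕ := fun c => (U.filter fun v => ¬ good v c).card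
  -- Double counting of the pairs `v ∈ U`, `c ∈ A` with `c` not good for `v`: if each `c` failed for
  -- more than `U.card / D` elements, there would be more than `A.card * U.card / D` pairs, hence
  -- more than the possible `U.card * β`.
  have h1 : ∑ c ∈ A, U.card < ∑ c ∈ A, D * f c := by
    refine Finset.sum_lt_sum_of_nonempty (Finset.card_pos.1 (by omega)) fun c hc => ?_
    have hc := Finset.mem_sdiff.1 hc
    obtain ⟨B, hB, hBg, hlt⟩ := hcon c (Finset.mem_range.1 hc.1) hc.2
    refine hlt.trans_le (Nat.mul_le_mul_left D (Finset.card_le_card fun v hv => ?_))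
    exact Finset.mem_filter.2 ⟨hB hv, hBg v hv⟩
  have h2 : ∑ c ∈ A, f c = ∑ v ∈ U, (A.filter fun c => ¬ good v c).card := by
    simp only [f, Finset.card_filter]
    exact Finset.sum_comm
  have h3 : ∑ v ∈ U, (A.filter fun c => ¬ good v c).card ≤ U.card * β := by
    refine (Finset.sum_le_card_nsmul _ _ β fun v hv => ?_).trans (by simp)
    refine hβ v hv _ fun c hc => ?_
    have hc := Finset.mem_filter.1 hc
    exact ⟨Finset.mem_range.1 (Finset.mem_sdiff.1 hc.1).1, hc.2⟩
  rw [← Finset.mul_sum, h2, Finset.sum_const, smul_eq_mul] at h1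
  have h4 : D * (U.card * β) ≤ A.card * U.card := by
    calc D * (U.card * β) = (D * β) * U.card := by ring
      _ ≤ A.card * U.card := Nat.mul_le_mul_right _ hA.le
  have := Nat.mul_le_mul_left D h3
  omega

/-- One step of the algorithm leaves at most the fraction `1 / D` of the clients on the lowest
level. -/
theorem exists_step {N D β : ℕ} (hD : 2 ≤ D) (hNn : N ≤ n) (hR : R ≤ n)
    (hβ : ∀ v < n, client v → ∀ B : Finset ℕ, (∀ c ∈ B, c < N ∧ ¬ good v c) → B.card ≤ β)
    (hS : S ⊆ Finset.range n) (hN : D * β + S.card < N) (h : level n client good S < R) :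
    (step n R client good S ⊆ Finset.range n ∧ S ⊆ step n R client good S ∧
      (step n R client good S).card = S.card + 1) ∧
      D * (behind n client good (step n R client good S) (level n client good S)).card ≤
        (behind n client good S (level n client good S)).card := by
  classical
  set r := level n client good S with hr
  obtain ⟨c, hc, hstep, hmax⟩ := exists_step_eq_insert (by omega) hS h
  set U := behind n client good S r with hU
  have hUpos : 0 < U.card := by
    have := (lt_level_iff (client := client) (good := good) (S := S) (z := r) (by omega)).not.1
      (lt_irrefl _)
    push Not at this
    obtain ⟨v, hv, hcl, hle⟩ := this
    exact Finset.card_pos.2 ⟨v, Finset.mem_filter.2 ⟨Finset.mem_range.2 hv, hcl, hle⟩⟩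
  obtain ⟨c₁, hc₁, hc₁S, hbad⟩ := exists_bad_le (good := good) (S := S) U N D β
    (fun v hv => by
      have hv := Finset.mem_filter.1 hv
      exact hβ v (Finset.mem_range.1 hv.1) hv.2.1) hN
  have hscore : ∀ i, i ∉ S → score n client good S i = (U.filter fun v => good v i).card := by
    intro i hi
    unfold score
    congr 1
    ext v
    simp only [hU, behind, Finset.mem_filter, hi, not_false_iff, and_true, ← hr, and_assoc]
  have h1 := hbad (U.filter fun v => ¬ good v c₁) (Finset.filter_subset _ _) (by simp)
  have h2 := Finset.card_filter_add_card_filter_not (s := U) (fun v => good v c₁)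
  have h3 := hmax c₁ (by omega)
  rw [hscore c₁ hc₁S] at h3
  -- Chosen indices have score `0`, whereas `c₁` is good for at least half of the nonempty set `U`,
  -- because `2 ≤ D`.
  have hcS : c ∉ S := by
    intro hcS
    have : score n client good S c = 0 := by
      simp [score, hcS]
    have h4 := Nat.mul_le_mul_right (U.filter fun v => ¬ good v c₁).card hD
    omega
  rw [hscore c hcS] at h3
  rw [hstep]
  refine ⟨⟨?_, Finset.subset_insert _ _, Finset.card_insert_of_notMem hcS⟩, ?_⟩
  · exact Finset.insert_subset (Finset.mem_range.2 hc) hS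
  · have h5 := Finset.card_filter_add_card_filter_not (s := U) (fun v => good v c)
    -- Every client had at least `r` good indices before, so a client for which `c` is good now has
    -- more than `r`.
    have h6 : behind n client good (insert c S) r ⊆ U.filter fun v => ¬ good v c := by
      intro v hv
      have hv := Finset.mem_filter.1 hv
      have hle : covered n good S v ≤ r := (covered_mono (Finset.subset_insert c S) v).trans hv.2.2
      refine Finset.mem_filter.2 ⟨Finset.mem_filter.2 ⟨hv.1, hv.2.1, hle⟩, fun hg => ?_⟩
      have h7 := covered_insert (n := n) hc hcS hg
      have h8 := le_covered (S := S) (good := good) (Finset.mem_range.1 hv.1) hv.2.1 (by omega)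
      have h9 := hv.2.2
      omega
    have h7 := Finset.card_le_card h6
    refine le_trans (Nat.mul_le_mul_left D ?_) h1
    omega

/-- The sets chosen by the greedy algorithm. -/
noncomputable def chosen (n R : ℕ) (client : ℕ → Prop) (good : ℕ → ℕ → Prop) (t : ℕ) : Finset ℕ :=
  (step n R client good)^[t] ∅

theorem chosen_succ (t : ℕ) :
    chosen n R client good (t + 1) = step n R client good (chosen n R client good t) :=
  Function.iterate_succ_apply' _ _ _

/-- Here `j` counts the steps spent on the current level. Each of them divides the number of clients
left there by `D`, and this number is positive, so `n < D ^ C` keeps `j` below `C`. Thus a level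
costs at most `C` steps; once level `R` is reached, the set no longer changes. -/
theorem chosen_invariant {N D β C : ℕ} (hD : 2 ≤ D) (hNn : N ≤ n) (hn : n < D ^ C) (hR : R ≤ n)
    (hβ : ∀ v < n, client v → ∀ B : Finset ℕ, (∀ c ∈ B, c < N ∧ ¬ good v c) → B.card ≤ β)
    (hN : D * β + C * R < N) (t : ℕ) :
    chosen n R client good t ⊆ Finset.range n ∧
    ((R ≤ level n client good (chosen n R client good t) ∧
      (chosen n R client good t).card ≤ C * R) ∨
    (level n client good (chosen n R client good t) < R ∧ (chosen n R client good t).card = t ∧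
      ∃ j < C, t ≤ C * level n client good (chosen n R client good t) + j ∧
        (behind n client good (chosen n R client good t)
          (level n client good (chosen n R client good t))).card * D ^ j ≤ n)) := by
  classical
  have hbehind : ∀ S : Finset ℕ, ∀ r, (behind n client good S r).card ≤ n := fun S r =>
    (Finset.card_filter_le _ _).trans (by simp)
  have hC : 0 < C := by
    by_contra h
    obtain rfl : C = 0 := by omega
    simp at hn
    omega
  induction t with
  | zero =>
    refine ⟨by simp [chosen], ?_⟩
    by_cases h : R ≤ level n client good (chosen n R client good 0)
    · exact .inl ⟨h, by simp [chosen]⟩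
    · exact .inr ⟨by omega, by simp [chosen], 0, hC, by omega, by simpa using hbehind _ _⟩
  | succ t ih =>
    rw [chosen_succ]
    obtain ⟨hS, ⟨h1, h2⟩ | ⟨h1, h2, j, hj, ht, hU⟩⟩ := ih
    · rw [step_of_le hS h1]
      exact ⟨hS, .inl ⟨h1, h2⟩⟩
    · set S := chosen n R client good t with hSdef
      set r := level n client good S with hr
      have hCr : C * r + C ≤ C * R := by
        rw [← Nat.mul_succ]
        exact Nat.mul_le_mul_left C h1
      obtain ⟨⟨hS', hsub, hcard⟩, hD'⟩ := exists_step hD hNn hR hβ hS (by omega) h1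
      rw [← hr] at hD'
      set S' := step n R client good S with hS'def
      refine ⟨hS', ?_⟩
      have hrr : r ≤ level n client good S' := by
        by_contra hlt
        push Not at hlt
        have := (lt_level_iff (client := client) (good := good) (S := S')
          (z := level n client good S') (by omega)).not.1 (lt_irrefl _)
        push Not at this
        obtain ⟨v, hv, hcl, hle⟩ := this
        have h3 := le_covered (S := S) (good := good) hv hcl (by omega)
        have h4 := covered_mono (n := n) (good := good) hsub v
        omega
      by_cases hdone : R ≤ level n client good S'
      · exact .inl ⟨hdone, by omega⟩
      · right
        push Not at hdone
        refine ⟨hdone, by omega, ?_⟩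
        rcases hrr.eq_or_lt with he | hlt
        · rw [← he]
          have hpos : 0 < (behind n client good S' r).card := by
            have := (lt_level_iff (n := n) (client := client) (good := good) (S := S') (z := r)
              (by omega)).not.1 (by omega)
            push Not at this
            obtain ⟨v, hv, hcl, hle⟩ := this
            exact Finset.card_pos.2 ⟨v, Finset.mem_filter.2 ⟨Finset.mem_range.2 hv, hcl, hle⟩⟩
          have hU' : (behind n client good S' r).card * D ^ (j + 1) ≤ n := by
            refine le_trans ?_ hU
            rw [pow_succ]
            calc _ = D * (behind n client good S' r).card * D ^ j := by ring
              _ ≤ _ := Nat.mul_le_mul_right _ hD'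
          refine ⟨j + 1, ?_, by omega, hU'⟩
          -- After `C` steps on one level, a single remaining client would imply `D ^ C ≤ n`.
          by_contra hCj
          have h5 : D ^ C ≤ D ^ (j + 1) := Nat.pow_le_pow_right (by omega) (by omega)
          have h6 := Nat.mul_le_mul hpos (le_refl (D ^ (j + 1)))
          omega
        · refine ⟨0, hC, ?_, by simpa using hbehind _ _⟩
          have := Nat.mul_le_mul_left C hlt
          rw [Nat.mul_succ] at this
          omega

/-- The greedy algorithm satisfies every client `R` times, and it chooses only few indices. -/
theorem chosen_spec {N D β C : ℕ} (hD : 2 ≤ D) (hNn : N ≤ n) (hn : n < D ^ C) (hR : R ≤ n)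
    (hβ : ∀ v < n, client v → ∀ B : Finset ℕ, (∀ c ∈ B, c < N ∧ ¬ good v c) → B.card ≤ β)
    (hN : D * β + C * R < N) :
    chosen n R client good n ⊆ Finset.range n ∧ (chosen n R client good n).card ≤ C * R ∧
      ∀ v < n, client v → R ≤ covered n good (chosen n R client good n) v := by
  obtain ⟨hS, ⟨h1, h2⟩ | ⟨h1, h2, j, hj, ht, hU⟩⟩ := chosen_invariant hD hNn hn hR hβ hN n
  · refine ⟨hS, h2, fun v hv hc => ?_⟩
    rcases Nat.eq_zero_or_pos R with rfl | hpos
    · omega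
    · have := (lt_level_iff (z := R - 1) (by omega)).1 (lt_of_lt_of_le (by omega) h1) v hv hc
      omega
  -- An unfinished run of `n` steps would give `n ≤ C * level + j < C * R < N ≤ n`.
  · exfalso
    have := Nat.mul_le_mul_left C h1
    rw [Nat.mul_succ] at this
    omega

end Greedy

/-! ### The graph that the algorithm constructs -/

namespace Anonymization

variable {n : ℕ} (G : SimpleGraph (Fin n)) (m k l : ℕ)

/-- Adjacency of vertices that are given by their numbers. -/
def Adj (x y : ℕ) : Prop := ∃ (hx : x < n) (hy : y < n), G.Adj ⟨x, hx⟩ ⟨y, hy⟩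

open Classical in
noncomputable def common (x y : ℕ) : ℕ :=
  ((Finset.range n).filter fun z => Adj G x z ∧ Adj G z y).card

open Classical in
noncomputable def degree (x : ℕ) : ℕ := ((Finset.range n).filter fun z => Adj G x z).card

/-- `x` and `y` share at least `l` neighbours. -/
def Partner (x y : ℕ) : Prop := x ≠ y ∧ l ≤ common G x y

/-- `y` must not be counted as a new partner of `x`. -/
def Bad (x y : ℕ) : Prop := x = y ∨ Partner G l x y ∨ Adj G x y ∧ degree G x ≤ l

open Classical in
/-- `x` has not enough partners yet. -/
def Client (x : ℕ) : Prop := ((Finset.range n).filter fun z => Partner G l x z).card < k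

variable (n) in
/-- The least size of a block, about `√(m * l)`. -/
def size : ℕ := ((Finset.range n).filter fun z => z * z < m * l).card + 2

variable (n) in
/-- The number of blocks; the block of a vertex is its residue modulo this number. -/
def blocks : ℕ := n / size n m l

variable (n) in
/-- The index by which `y` is reached from `x`: the number of `y` if hubs are chosen, the difference
of the blocks otherwise. -/
def shift (x y : ℕ) : ℕ :=
  if m < l then y
  else (y % blocks n m l + blocks n m l - x % blocks n m l) % blocks n m l

open Classical in
/-- The number of new partners that index `c` can yield for `x`. -/
noncomputable def gain (x c : ℕ) : ℕ :=
  ((Finset.range n).filter fun z => ¬ Bad G l x z ∧ shift n m l x z = c).card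

variable (n) in
/-- A lower bound for the number of vertices reached by an index. -/
def width : ℕ := if m < l then 1 else size n m l

variable (n) in
/-- The number of classes into which each block is split. -/
def classes : ℕ := if m < l then 1 else size n m l / (l + 2)

variable (n) in
/-- The number of good indices that each vertex needs. -/
def rounds : ℕ := ((Finset.range n).filter fun z => z * width n m l < m + m).card

def Good (x c : ℕ) : Prop := width n m l ≤ gain G m l x c + gain G m l x c

/-- The indices chosen by the greedy algorithm. -/
noncomputable def chosen : Finset ℕ :=
  Greedy.chosen n (rounds n m l) (Client G k l) (Good G m l) n

noncomputable def rank (c : ℕ) : ℕ :=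
  ((Finset.range n).filter fun z => z < c ∧ z ∈ chosen G m k l).card

/-- `x` is to be joined to `y`. -/
def Link (x y : ℕ) : Prop :=
  shift n m l x y = 0 ∨ shift n m l x y ∈ chosen G m k l ∧
    x / blocks n m l % classes n m l =
      rank G m k l (shift n m l x y) % classes n m l

end Anonymization

/-! ### The meaning of the tables -/

theorem Finset.card_filter_congr' {n : ℕ} {P Q : ℕ → Prop} {_ : DecidablePred P}
    {_ : DecidablePred Q}     (h : ∀ z < n, P z ↔ Q z) :
    ((Finset.range n).filter P).card = ((Finset.range n).filter Q).card := by
  congr 1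
  ext z
  simp only [Finset.mem_filter, Finset.mem_range]
  exact and_congr_right (h z)

/-- The number of `z < n` with `(z + 1) * b ≤ a` is `a / b`. -/
theorem card_filter_mul_add_le {n a b : ℕ} (hb : 0 < b) (ha : a ≤ n) :
    ((Finset.range n).filter fun z => z * b + b ≤ a).card = a / b := by
  have : (Finset.range n).filter (fun z => z * b + b ≤ a) = Finset.range (a / b) := by
    ext z
    have h : a / b ≤ a := Nat.div_le_self a b
    simp only [Finset.mem_filter, Finset.mem_range]
    rw [← Nat.succ_le_iff (n := a / b), Nat.le_div_iff_mul_le hb, Nat.succ_mul]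
    refine ⟨fun h => h.2, fun h' => ⟨?_, h'⟩⟩
    have : z < a / b := by rwa [← Nat.succ_le_iff, Nat.le_div_iff_mul_le hb, Nat.succ_mul]
    omega
  rw [this, Finset.card_range]

/-- All equations given by the operations hold for the arrays. -/
def Solves (ρ : ℕ → ℕ) (L : List TableOp) (F : Arrays) : Prop :=
  ∀ o ∈ L, ∀ x < ρ 0, ∀ y < ρ 0, F o.target x y = o.entry ρ F x y

theorem SingleAssignment.solves {ρ : ℕ → ℕ} {L : List TableOp} (hL : SingleAssignment L)
    (F : Arrays) : Solves ρ L (applyOps ρ L F) :=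
  fun _ ho _ hx _ hy => SingleAssignment.apply_eq hL F ho hx hy

theorem Solves.congr {ρ : ℕ → ℕ} {L : List TableOp} {F F' : Arrays} (h : Solves ρ L F)
    (hL : ∀ o ∈ L, o.Valid) (hF : ∀ o ∈ L, ∀ a ∈ o.target :: o.arrays, F a = F' a) :
    Solves ρ L F' := by
  intro o ho x hx y hy
  rw [← hF o ho _ (by simp), h o ho x hx y hy]
  exact TableOp.entry_congr (hL o ho) fun a ha => hF o ho a (by simp [ha])

/-- The content of the registers at the start. -/
def parameters (n k₀ k l : ℕ) (x : ℕ) : ℕ :=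
  if x = 0 then n else if x = 1 then k₀ else if x = 2 then k else if x = 3 then l else 0

namespace Anonymizer

open Expr Anonymization

theorem entry_count {ρ : ℕ → ℕ} {F : Arrays} {a x y : ℕ} {g : Expr} :
    (count a g).entry ρ F x y =
      ((Finset.range (ρ 0)).filter fun z => g.eval (evalState ρ F x y z) ≠ 0).card := by
  rw [Finset.card_filter]
  rfl

theorem entry_point {ρ : ℕ → ℕ} {F : Arrays} {a x y : ℕ} {g : Expr} (hx : x < ρ 0) :
    (point a g).entry ρ F x y = if g.eval (evalState ρ F x y x) ≠ 0 then 1 else 0 := by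
  have : (point a g).entry ρ F x y = ∑ z ∈ Finset.range (ρ 0),
      if z = x then (if g.eval (evalState ρ F x y x) ≠ 0 then 1 else 0) else 0 := by
    refine Finset.sum_congr rfl fun z _ => ?_
    simp only [point, eval_conj, eval_eql]
    have hz : Z.eval (evalState ρ F x y z) = z := rfl
    have hx : X.eval (evalState ρ F x y z) = x := rfl
    rw [hz, hx]
    by_cases h : z = x
    · subst h
      simp [Expr.eval]
    · simp [h]
  rw [this, Finset.sum_ite_eq' (Finset.range (ρ 0)) x, if_pos (Finset.mem_range.2 hx)]

section Pre

variable {n k₀ k l : ℕ} {G : SimpleGraph (Fin n)} {F : Arrays}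

theorem adjEntry_ne_zero {x y : ℕ} : adjEntry G x y ≠ 0 ↔ Adj G x y := by
  unfold adjEntry Adj
  split_ifs with h <;> simp [h]

theorem common_eq (hF : Solves (parameters n k₀ k l) pre F) (h0 : ∀ x y, F 0 x y = adjEntry G x y)
    {x y : ℕ} (hx : x < n) (hy : y < n) : F 1 x y = common G x y := by
  rw [common, show F 1 x y = _ from (hF opCommon (by simp [pre]) x hx y hy).trans entry_count]
  refine Finset.card_filter_congr' fun z _ => ?_
  simp [eval_conj, Expr.eval, evalState, X, Y, Z, h0, adjEntry_ne_zero]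

theorem degree_eq (hF : Solves (parameters n k₀ k l) pre F) (h0 : ∀ x y, F 0 x y = adjEntry G x y)
    {x y : ℕ} (hx : x < n) (hy : y < n) : F 2 x y = degree G x := by
  rw [degree, show F 2 x y = _ from (hF opDegree (by simp [pre]) x hx y hy).trans entry_count]
  refine Finset.card_filter_congr' fun z _ => ?_
  simp [Expr.eval, evalState, X, Z, h0, adjEntry_ne_zero]

theorem point_ne_zero {L : List TableOp} {ρ : ℕ → ℕ} (hF : Solves ρ L F) {a : ℕ} {g : Expr}
    (h : point a g ∈ L) {x y : ℕ} (hx : x < ρ 0) (hy : y < ρ 0) :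
    F a x y ≠ 0 ↔ g.eval (evalState ρ F x y x) ≠ 0 := by
  rw [show F a x y = _ from (hF _ h x hx y hy).trans (entry_point hx)]
  simp

theorem partner_iff (hF : Solves (parameters n k₀ k l) pre F)
    (h0 : ∀ x y, F 0 x y = adjEntry G x y) {x y : ℕ} (hx : x < n) (hy : y < n) :
    F 3 x y ≠ 0 ↔ Partner G l x y := by
  rw [point_ne_zero hF (show opPartner ∈ pre by simp [pre]) hx hy, eval_conj, eval_leq, eval_neg]
  have : (eql X Y).eval (evalState (parameters n k₀ k l) F x y x) = 0 ↔ x ≠ y := by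
    rw [← not_iff_not, ← ne_eq, eval_eql, not_not]
    rfl
  rw [this]
  simp [Expr.eval, evalState, X, Y, parameters, Partner, common_eq hF h0 hx hy]

theorem bad_iff (hF : Solves (parameters n k₀ k l) pre F)
    (h0 : ∀ x y, F 0 x y = adjEntry G x y) {x y : ℕ} (hx : x < n) (hy : y < n) :
    F 4 x y ≠ 0 ↔ Bad G l x y := by
  have h3 := partner_iff hF h0 hx hy
  rw [point_ne_zero hF (show opBad ∈ pre by simp [pre]) hx hy, eval_disj, eval_disj, eval_conj, eval_leq,
    eval_eql]
  simp only [Expr.eval, evalState, X, Y, row, parameters, h0, adjEntry_ne_zero, Bad, ← h3]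
  simp [degree_eq hF h0 hx (show 0 < n by omega)]

theorem partners_eq (hF : Solves (parameters n k₀ k l) pre F)
    (h0 : ∀ x y, F 0 x y = adjEntry G x y) {x y : ℕ} (hx : x < n) (hy : y < n) :
    F 5 x y < k ↔ Client G k l x := by
  rw [Client, show F 5 x y = _ from (hF opPartners (by simp [pre]) x hx y hy).trans entry_count]
  exact (Finset.card_filter_congr' fun z hz => partner_iff hF h0 hx hz) ▸ Iff.rfl

theorem mul_eq (hF : Solves (parameters n k₀ k l) pre F) {x y : ℕ} (hx : x < n) (hy : y < n) :
    F 7 x y = x * y := by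
  have h : F 7 x y = opMul.entry (parameters n k₀ k l) F x y :=
    hF opMul (by simp [pre]) x hx y hy
  rw [h]
  simp only [TableOp.entry, opMul, eval_less]
  have : ∀ z, Z.eval (evalState (parameters n k₀ k l) F x y z) = z := fun _ => rfl
  have : ∀ z, X.eval (evalState (parameters n k₀ k l) F x y z) = x := fun _ => rfl
  have : ∀ z, Y.eval (evalState (parameters n k₀ k l) F x y z) = y := fun _ => rfl
  simp only [*]
  rw [← Finset.sum_filter, Finset.sum_const, smul_eq_mul]
  congr 1
  have : (Finset.range (parameters n k₀ k l 0)).filter (· < x) = Finset.range x := by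
    ext z
    have : parameters n k₀ k l 0 = n := rfl
    simp only [this, Finset.mem_filter, Finset.mem_range]
    omega
  rw [this, Finset.card_range]

variable (n k₀ k l) in
/-- The numbers involved are small enough for the multiplication table. -/
structure SmallParameters : Prop where
  k_lt : k < n
  l_lt : l + 2 < n
  size_lt : size n (k - k₀) l < n

section

variable (hF : Solves (parameters n k₀ k l) pre F) (h0 : ∀ x y, F 0 x y = adjEntry G x y)
  (hs : SmallParameters n k₀ k l)

theorem SmallParameters.blocks_lt (hs : SmallParameters n k₀ k l) :
    blocks n (k - k₀) l < n :=
  Nat.div_lt_self (by have := hs.k_lt; omega) (by unfold size; omega)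

theorem SmallParameters.blocks_pos (hs : SmallParameters n k₀ k l) :
    0 < blocks n (k - k₀) l :=
  Nat.div_pos hs.size_lt.le (by unfold size; omega)

include hF hs

theorem size_eq : F 8 0 0 + 2 = size n (k - k₀) l := by
  have h := hs.k_lt
  have h' := hs.l_lt
  have hn : 0 < n := by omega
  rw [size, show F 8 0 0 = _ from (hF opRoot (by simp [pre]) 0 hn 0 hn).trans entry_count]
  congr 1
  refine Finset.card_filter_congr' fun z hz => ?_
  rw [eval_less]
  simp [Expr.eval, evalState, Z, need, parameters, mul_eq hF hz hz,
    mul_eq hF (show k - k₀ < n by omega) (show l < n by omega)]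

theorem blocks_eq : F 9 0 0 = blocks n (k - k₀) l := by
  have h := hs.k_lt
  have hn : 0 < n := by omega
  have h8 := size_eq hF hs
  rw [blocks, ← card_filter_mul_add_le (n := n) (by unfold size; omega) le_rfl,
    show F 9 0 0 = _ from (hF opBlocks (by simp [pre]) 0 hn 0 hn).trans entry_count]
  refine Finset.card_filter_congr' fun z hz => ?_
  rw [eval_leq]
  simp [Expr.eval, evalState, Z, sizeExpr, scalar, parameters, h8, mul_eq hF hz hs.size_lt]

theorem quotient_eq {x y : ℕ} (hx : x < n) (hy : y < n) :
    F 10 x y = x / blocks n (k - k₀) l := by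
  have h := hs.k_lt
  have h9 := blocks_eq hF hs
  have hb : 0 < blocks n (k - k₀) l := hs.blocks_pos
  rw [← card_filter_mul_add_le (n := n) hb hx.le,
    show F 10 x y = _ from (hF opQuotient (by simp [pre]) x hx y hy).trans entry_count]
  refine Finset.card_filter_congr' fun z hz => ?_
  rw [eval_leq]
  simp [Expr.eval, evalState, X, Z, scalar, h9, mul_eq hF hz hs.blocks_lt]

theorem residue_eq {x : ℕ} (hx : x < n) :
    x - F 7 (F 10 x 0) (F 9 0 0) = x % blocks n (k - k₀) l := by
  have hn : 0 < n := by omega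
  rw [quotient_eq hF hs hx hn, blocks_eq hF hs,
    mul_eq hF ((Nat.div_le_self x _).trans_lt hx) hs.blocks_lt]
  have := Nat.div_add_mod' x (blocks n (k - k₀) l)
  omega

theorem shift_eq {x y : ℕ} (hx : x < n) (hy : y < n) :
    F 12 x y = shift n (k - k₀) l x y := by
  have h : F 12 x y = opShift.entry (parameters n k₀ k l) F x y :=
    hF opShift (by simp [pre]) x hx y hy
  -- For blocks, with residues `x'` and `y'` modulo `b`, the cyclic difference is the only `z < b`
  -- for which `x' + z` is `y'` or `y' + b`.
  have key : ∀ z < n, opShift.guard.eval (evalState (parameters n k₀ k l) F x y z) ≠ 0 ↔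
      z = shift n (k - k₀) l x y := by
    intro z hz
    have hh : hub.eval (evalState (parameters n k₀ k l) F x y z) ≠ 0 ↔ k - k₀ < l := by
      rw [hub, eval_less]
      simp [Expr.eval, evalState, need, parameters]
    have hh' : hub.eval (evalState (parameters n k₀ k l) F x y z) = 0 ↔ ¬ k - k₀ < l := by
      rw [← hh, not_not]
    simp only [opShift, eval_disj, eval_conj, eval_neg, eval_eql, eval_less, hh, hh']
    simp only [Expr.eval, evalState, X, Y, Z, residue, row, scalar]
    simp only [reduceIte, Nat.reduceEqDiff, residue_eq hF hs hx, residue_eq hF hs hy]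
    simp only [blocks_eq hF hs, shift]
    have hb : 0 < blocks n (k - k₀) l := hs.blocks_pos
    have hx' := Nat.mod_lt x hb
    have hy' := Nat.mod_lt y hb
    generalize blocks n (k - k₀) l = b at *
    generalize x % b = x' at *
    generalize y % b = y' at *
    by_cases hhub : k - k₀ < l
    · simp [hhub]
    · simp only [hhub, false_and, not_false_iff, true_and, false_or, if_false]
      by_cases hxy : x' ≤ y'
      · rw [show y' + b - x' = (y' - x') + b by omega, Nat.add_mod_right, Nat.mod_eq_of_lt (by omega)]
        omega
      · rw [Nat.mod_eq_of_lt (by omega)]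
        omega
  have hlt : shift n (k - k₀) l x y < n := by
    unfold shift
    split_ifs
    · exact hy
    · exact (Nat.mod_lt _ hs.blocks_pos).trans hs.blocks_lt
  rw [h, TableOp.entry]
  have : ∀ z ∈ Finset.range n, (if opShift.guard.eval (evalState (parameters n k₀ k l) F x y z) ≠ 0
      then opShift.value.eval (evalState (parameters n k₀ k l) F x y z) else 0) =
      if z = shift n (k - k₀) l x y then z else 0 := by
    intro z hz
    simp only [key z (Finset.mem_range.1 hz)]
    rfl
  refine (Finset.sum_congr rfl this).trans ?_
  rw [Finset.sum_ite_eq' (Finset.range n), if_pos (Finset.mem_range.2 hlt)]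

theorem width_eq : F 14 0 0 = width n (k - k₀) l := by
  have h := hs.k_lt
  have hn : 0 < n := by omega
  have h8 := size_eq hF hs
  have hsz := hs.size_lt
  rw [show F 14 0 0 = _ from (hF opWidth (by simp [pre]) 0 hn 0 hn).trans entry_count]
  have hh : ∀ z, hub.eval (evalState (parameters n k₀ k l) F 0 0 z) ≠ 0 ↔ k - k₀ < l := by
    intro z
    rw [hub, eval_less]
    simp [Expr.eval, evalState, need, parameters]
  have hh' : ∀ z, hub.eval (evalState (parameters n k₀ k l) F 0 0 z) = 0 ↔ ¬ k - k₀ < l := by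
    intro z
    rw [← hh z, not_not]
  have : ∀ N ≤ n, ((Finset.range n).filter (· < N)).card = N := by
    intro N hN
    have : (Finset.range n).filter (· < N) = Finset.range N := by
      ext z
      simp only [Finset.mem_filter, Finset.mem_range]
      omega
    rw [this, Finset.card_range]
  rw [← this (width n (k - k₀) l) (by unfold width; split_ifs <;> omega)]
  refine Finset.card_filter_congr' fun z hz => ?_
  simp only [eval_disj, eval_conj, eval_neg, eval_less, hh, hh', width]
  simp only [Expr.eval, evalState, Z, sizeExpr, scalar, h8, reduceIte, Nat.reduceEqDiff]
  split_ifs with hhub <;> simp [hhub]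

theorem classes_eq : F 15 0 0 = classes n (k - k₀) l := by
  have h := hs.k_lt
  have hn : 0 < n := by omega
  have h8 := size_eq hF hs
  have hsz := hs.size_lt
  rw [show F 15 0 0 = _ from (hF opClasses (by simp [pre]) 0 hn 0 hn).trans entry_count]
  have hh : ∀ z, hub.eval (evalState (parameters n k₀ k l) F 0 0 z) ≠ 0 ↔ k - k₀ < l := by
    intro z
    rw [hub, eval_less]
    simp [Expr.eval, evalState, need, parameters]
  have hh' : ∀ z, hub.eval (evalState (parameters n k₀ k l) F 0 0 z) = 0 ↔ ¬ k - k₀ < l := by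
    intro z
    rw [← hh z, not_not]
  have : ∀ z < n, (disj (conj hub (less Z (.const 1))) (conj (neg hub)
      (leq (.add (.cell 7 Z (.add (.reg 3) (.const 2))) (.add (.reg 3) (.const 2))) sizeExpr))).eval
      (evalState (parameters n k₀ k l) F 0 0 z) ≠ 0 ↔
      if k - k₀ < l then z * 1 + 1 ≤ 1 else z * (l + 2) + (l + 2) ≤ size n (k - k₀) l := by
    intro z hz
    simp only [eval_disj, eval_conj, eval_neg, eval_less, eval_leq, hh, hh']
    simp only [Expr.eval, evalState, Z, sizeExpr, scalar, h8, reduceIte, Nat.reduceEqDiff,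
      show parameters n k₀ k l 3 = l from rfl, mul_eq hF hz hs.l_lt]
    split_ifs with hhub <;> simp [hhub]
  unfold classes
  by_cases hhub : k - k₀ < l
  · simp only [hhub, if_true] at this ⊢
    exact (Finset.card_filter_congr' this).trans
      ((card_filter_mul_add_le one_pos (by omega)).trans (Nat.div_one 1))
  · simp only [hhub, if_false] at this ⊢
    exact (Finset.card_filter_congr' this).trans (card_filter_mul_add_le (by omega) (by omega))

theorem rounds_eq : F 16 0 0 = rounds n (k - k₀) l := by
  have h := hs.k_lt
  have hn : 0 < n := by omega
  have h14 := width_eq hF hs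
  have hsz := hs.size_lt
  have hw : width n (k - k₀) l < n := by
    have := hs.l_lt
    unfold width
    split_ifs <;> omega
  rw [rounds, show F 16 0 0 = _ from (hF opRounds (by simp [pre]) 0 hn 0 hn).trans entry_count]
  refine Finset.card_filter_congr' fun z hz => ?_
  rw [eval_less]
  simp [Expr.eval, evalState, Z, need, scalar, parameters, h14, mul_eq hF hz hw]

include h0

theorem gain_eq {x c : ℕ} (hx : x < n) (hc : c < n) :
    F 13 x c = gain G (k - k₀) l x c := by
  rw [gain, show F 13 x c = _ from (hF opGain (by simp [pre]) x hx c hc).trans entry_count]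
  refine Finset.card_filter_congr' fun z hz => ?_
  have h4 := bad_iff hF h0 hx hz
  simp only [eval_conj, eval_neg, eval_eql]
  simp only [Expr.eval, evalState, X, Y, Z, reduceIte, Nat.reduceEqDiff, shift_eq hF hs hx hz]
  rw [← h4, not_not]

theorem good_iff {x c : ℕ} (hx : x < n) (hc : c < n) :
    F 14 0 0 ≤ F 13 x c + F 13 x c ↔ Good G (k - k₀) l x c := by
  rw [width_eq hF hs, gain_eq hF h0 hs hx hc]
  rfl

end

end Pre

end Anonymizer

/-! ### The tables of the greedy rounds and of the new edges. -/

namespace Anonymizer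

open Expr Anonymization

section Body

variable {n k₀ k l : ℕ} {G : SimpleGraph (Fin n)} {F : Arrays} {S : Finset ℕ}

/-- The loop and `postPlan` write only to tables from `20` on, so the equations of `pre` survive
them. -/
theorem Solves.of_eq_below {ρ : ℕ → ℕ} {F F' : Arrays} (h : Solves ρ pre F)
    (h' : ∀ a < 20, F' a = F a) : Solves ρ pre F' :=
  h.congr (SingleAssignment.valid pre_singleAssignment) fun o ho a ha => by
    have : ∀ o ∈ pre, ∀ a ∈ o.target :: o.arrays, a < 20 := by decide
    exact (h' a (this o ho a ha)).symm

theorem client_iff (hF : Solves (parameters n k₀ k l) pre F)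
    (h0 : ∀ x y, F 0 x y = adjEntry G x y) {v : Expr} {x y z w : ℕ} (hw : w < n)
    (hv : v.eval (evalState (parameters n k₀ k l) F x y z) = w) :
    (client v).eval (evalState (parameters n k₀ k l) F x y z) ≠ 0 ↔ Client G k l w := by
  rw [client, eval_less, ← partners_eq hF h0 hw (show 0 < n by omega)]
  simp only [row, Expr.eval, hv]
  rfl

theorem good_eval_iff (hF : Solves (parameters n k₀ k l) pre F)
    (h0 : ∀ x y, F 0 x y = adjEntry G x y) (hs : SmallParameters n k₀ k l)
    {v c : Expr} {x y z w i : ℕ} (hw : w < n) (hi : i < n)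
    (hv : v.eval (evalState (parameters n k₀ k l) F x y z) = w)
    (hc : c.eval (evalState (parameters n k₀ k l) F x y z) = i) :
    (good v c).eval (evalState (parameters n k₀ k l) F x y z) ≠ 0 ↔
      Good G (k - k₀) l w i := by
  rw [good, eval_leq, ← good_iff hF h0 hs hw hi]
  simp only [scalar, Expr.eval, hv, hc]
  rfl

theorem eval_X {ρ : ℕ → ℕ} {x y z : ℕ} : X.eval (evalState ρ F x y z) = x := rfl
theorem eval_Y {ρ : ℕ → ℕ} {x y z : ℕ} : Y.eval (evalState ρ F x y z) = y := rfl
theorem eval_Z {ρ : ℕ → ℕ} {x y z : ℕ} : Z.eval (evalState ρ F x y z) = z := rfl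
theorem eval_row {ρ : ℕ → ℕ} {x y z a : ℕ} {e : Expr} :
    (row a e).eval (evalState ρ F x y z) = F a (e.eval (evalState ρ F x y z)) 0 := rfl
theorem eval_scalar {ρ : ℕ → ℕ} {x y z a : ℕ} :
    (scalar a).eval (evalState ρ F x y z) = F a 0 0 := rfl

/-- The tables that are computed in each round of the loop. -/
theorem body_spec (hF : Solves (parameters n k₀ k l) pre F)
    (h0 : ∀ x y, F 0 x y = adjEntry G x y) (hs : SmallParameters n k₀ k l)
    (hB : Solves (parameters n k₀ k l) bodyPlan F)
    (hS : ∀ x < n, ∀ y < n, F 20 x y ≠ 0 ↔ x ∈ S) {x y : ℕ} (hx : x < n) (hy : y < n) :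
    F 26 x y ≠ 0 ↔
      x ∈ Greedy.step n (rounds n (k - k₀) l) (Client G k l) (Good G (k - k₀) l) S := by
  classical
  have hn : 0 < n := by omega
  have h21 : ∀ v < n, F 21 v 0 = Greedy.covered n (Good G (k - k₀) l) S v := by
    intro v hv
    rw [Greedy.covered, show F 21 v 0 = _ from
      (hB opCount (by simp [bodyPlan]) v hv 0 hn).trans entry_count]
    refine Finset.card_filter_congr' fun z hz => ?_
    rw [eval_conj, good_eval_iff hF h0 hs hv hz rfl rfl, eval_row, eval_Z, hS z hz 0 hn]
  have h22 : ∀ z < n, F 22 z 0 = 0 ↔ ¬ ∃ v < n, Client G k l v ∧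
      Greedy.covered n (Good G (k - k₀) l) S v ≤ z := by
    intro z hz
    rw [show F 22 z 0 = _ from (hB opBehind (by simp [bodyPlan]) z hz 0 hn).trans entry_count,
      Finset.card_eq_zero, Finset.filter_eq_empty_iff]
    push Not
    refine forall_congr' fun v => ?_
    have hr : v ∈ Finset.range (parameters n k₀ k l 0) ↔ v < n := Finset.mem_range
    rw [hr]
    refine imp_congr_right fun hv => ?_
    rw [← not_iff_not, ← ne_eq, eval_conj, client_iff hF h0 hv rfl, eval_leq, eval_row,
      eval_Z, eval_X, h21 v hv]
    push Not
    rfl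
  have h23 : F 23 0 0 = Greedy.level n (Client G k l) (Good G (k - k₀) l) S := by
    rw [Greedy.level, show F 23 0 0 = _ from
      (hB opLevel (by simp [bodyPlan]) 0 hn 0 hn).trans entry_count]
    refine Finset.card_filter_congr' fun z hz => ?_
    rw [eval_neg, eval_row, eval_Z, h22 z hz, Finset.card_eq_zero, Finset.filter_eq_empty_iff]
    simp
  have h24 : ∀ c < n, F 24 c 0 =
      Greedy.score n (Client G k l) (Good G (k - k₀) l) S c := by
    intro c hc
    rw [Greedy.score, show F 24 c 0 = _ from
      (hB opScore (by simp [bodyPlan]) c hc 0 hn).trans entry_count]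
    refine Finset.card_filter_congr' fun v hv => ?_
    rw [eval_conj, eval_conj, eval_conj, client_iff hF h0 hv rfl, good_eval_iff hF h0 hs hv hc rfl rfl,
      eval_leq, eval_neg, eval_row, eval_Z, eval_row, eval_X, eval_scalar, h21 v hv, h23,
      ← hS c hc 0 hn, not_not]
  rw [point_ne_zero hB (show opNext ∈ bodyPlan by simp [bodyPlan]) hx hy, eval_disj, eval_conj,
    eval_less, eval_neg, eval_row, eval_row, eval_X, eval_scalar, eval_scalar, h23,
    rounds_eq hF hs, hS x hx 0 hn]
  have h25 : F 25 x 0 = ((Finset.range n).filter fun z =>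
      Greedy.score n (Client G k l) (Good G (k - k₀) l) S x <
        Greedy.score n (Client G k l) (Good G (k - k₀) l) S z ∨
      Greedy.score n (Client G k l) (Good G (k - k₀) l) S x =
        Greedy.score n (Client G k l) (Good G (k - k₀) l) S z ∧ z < x).card := by
    rw [show F 25 x 0 = _ from (hB opBeaten (by simp [bodyPlan]) x hx 0 hn).trans entry_count]
    refine Finset.card_filter_congr' fun z hz => ?_
    rw [eval_disj, eval_conj, eval_less, eval_eql, eval_less, eval_row, eval_row, eval_X, eval_Z,
      h24 x hx, h24 z hz]
  rw [h25]
  simp only [Greedy.step, Finset.mem_filter, Finset.mem_range, hx, true_and, Finset.card_eq_zero,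
    Finset.filter_eq_empty_iff]

theorem body_step (hF : Solves (parameters n k₀ k l) pre F)
    (h0 : ∀ x y, F 0 x y = adjEntry G x y) (hs : SmallParameters n k₀ k l)
    (hS : ∀ x < n, ∀ y < n, F 20 x y ≠ 0 ↔ x ∈ S) :
    (∀ a < 20, applyOps (parameters n k₀ k l) body F a = F a) ∧
    ∀ x < n, ∀ y < n, applyOps (parameters n k₀ k l) body F 20 x y ≠ 0 ↔
      x ∈ Greedy.step n (rounds n (k - k₀) l) (Client G k l) (Good G (k - k₀) l) S := by
  set F' := applyOps (parameters n k₀ k l) bodyPlan F with hF'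
  have hbody : applyOps (parameters n k₀ k l) body F =
      opCopyChosen.apply (parameters n k₀ k l) F' := by
    simp only [applyOps, body, List.foldl_append, hF']
    rfl
  have hlt : ∀ a < 21, F' a = F a := by
    intro a ha
    refine applyOps_of_notMem fun h => ?_
    have : ∀ o ∈ bodyPlan, 20 < o.target := by decide
    obtain ⟨o, ho, rfl⟩ := List.mem_map.1 h
    have := this o ho
    omega
  rw [hbody]
  constructor
  · intro a ha
    rw [← hlt a (by omega)]
    funext x y
    simp only [TableOp.apply, show opCopyChosen.target = 20 from rfl, show a ≠ 20 by omega,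
      false_and, if_false]
  · intro x hx y hy
    have h0' : ∀ x y, F' 0 x y = adjEntry G x y := by
      intro x y
      rw [hlt 0 (by omega), h0]
    have h26 := body_spec (Solves.of_eq_below hF fun a ha => hlt a (by omega)) h0' hs
      (SingleAssignment.solves bodyPlan_singleAssignment F) (S := S)
      (by rw [hlt 20 (by omega)]; exact hS) hx (show 0 < n by omega)
    have hp : parameters n k₀ k l 0 = n := rfl
    rw [← h26]
    simp only [TableOp.apply, show opCopyChosen.target = 20 from rfl, hp, hx, hy, true_and, if_true]
    rw [show opCopyChosen.entry (parameters n k₀ k l) F' x y = _ from entry_point hx]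
    by_cases h : F' 26 x 0 = 0 <;> simp [eval_row, eval_X, h]

theorem loop_spec (hF : Solves (parameters n k₀ k l) pre F)
    (h0 : ∀ x y, F 0 x y = adjEntry G x y) (hs : SmallParameters n k₀ k l)
    (hS : ∀ x y, F 20 x y = 0) (t : ℕ) :
    (∀ a < 20, (applyOps (parameters n k₀ k l) body)^[t] F a = F a) ∧
    ∀ x < n, ∀ y < n, (applyOps (parameters n k₀ k l) body)^[t] F 20 x y ≠ 0 ↔
      x ∈ Greedy.chosen n (rounds n (k - k₀) l) (Client G k l) (Good G (k - k₀) l) t := by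
  induction t with
  | zero => simp [hS, Greedy.chosen]
  | succ t ih =>
    rw [Function.iterate_succ_apply', Greedy.chosen_succ]
    obtain ⟨h1, h2⟩ := body_step (Solves.of_eq_below hF ih.1)
      (by intro x y; rw [ih.1 0 (by omega), h0]) hs ih.2
    exact ⟨fun a ha => (h1 a ha).trans (ih.1 a ha), h2⟩

theorem post_spec (hF : Solves (parameters n k₀ k l) pre F) (hs : SmallParameters n k₀ k l)
    (hP : Solves (parameters n k₀ k l) postPlan F)
    (hS : ∀ x < n, ∀ y < n, F 20 x y ≠ 0 ↔ x ∈ chosen G (k - k₀) k l) {x y : ℕ} (hx : x < n)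
    (hy : y < n) : F 33 x y ≠ 0 ↔ Link G (k - k₀) k l x y := by
  have hn : 0 < n := by omega
  have h15 := classes_eq hF hs
  have hl := hs.l_lt
  have hsz := hs.size_lt
  -- With blocks, `l ≤ k - k₀`, so each `z < l` satisfies `z * z < (k - k₀) * l`; a block therefore
  -- has room for at least one class of `l + 2` vertices.
  have hcl : 0 < classes n (k - k₀) l := by
    unfold classes
    split_ifs with h
    · omega
    · refine Nat.div_pos ?_ (by omega)
      unfold Anonymization.size
      have : Finset.range l ⊆ (Finset.range n).filter fun z => z * z < (k - k₀) * l := by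
        intro z hz
        have hz := Finset.mem_range.1 hz
        refine Finset.mem_filter.2 ⟨Finset.mem_range.2 (by omega), ?_⟩
        exact Nat.mul_lt_mul'' (by omega) hz
      have := Finset.card_le_card this
      rw [Finset.card_range] at this
      omega
  have hcn : classes n (k - k₀) l < n := by
    unfold classes
    split_ifs
    · omega
    · exact (Nat.div_le_self _ _).trans_lt hsz
  have h30 : ∀ c < n, F 30 c 0 = rank G (k - k₀) k l c := by
    intro c hc
    rw [rank, show F 30 c 0 = _ from
      (hP opRank (by simp [postPlan]) c hc 0 hn).trans entry_count]
    refine Finset.card_filter_congr' fun z hz => ?_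
    rw [eval_conj, eval_less, eval_row, eval_X, eval_Z, hS z hz 0 hn]
  have hrank : ∀ c, rank G (k - k₀) k l c ≤ n := fun c =>
    (Finset.card_filter_le _ _).trans (by simp)
  have hmod : ∀ a, a - a / classes n (k - k₀) l * classes n (k - k₀) l =
      a % classes n (k - k₀) l := by
    intro a
    have := Nat.div_add_mod' a (classes n (k - k₀) l)
    omega
  have h31 : ∀ c < n, F 31 c 0 = rank G (k - k₀) k l c / classes n (k - k₀) l := by
    intro c hc
    rw [← card_filter_mul_add_le hcl (hrank c), show F 31 c 0 = _ from
      (hP opRankQuotient (by simp [postPlan]) c hc 0 hn).trans entry_count]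
    refine Finset.card_filter_congr' fun z hz => ?_
    rw [eval_leq, eval_row, eval_X, h30 c hc]
    simp only [Expr.eval, eval_scalar, eval_Z, h15]
    simp only [evalState, mul_eq hF hz hcn]
  have h32 : ∀ c < n, F 32 c 0 = c / blocks n (k - k₀) l / classes n (k - k₀) l := by
    intro c hc
    rw [← card_filter_mul_add_le hcl ((Nat.div_le_self _ _).trans hc.le), show F 32 c 0 = _ from
      (hP opSubQuotient (by simp [postPlan]) c hc 0 hn).trans entry_count]
    refine Finset.card_filter_congr' fun z hz => ?_
    rw [eval_leq, eval_row, eval_X, quotient_eq hF hs hc hn]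
    simp only [Expr.eval, eval_scalar, eval_Z, h15]
    simp only [evalState, mul_eq hF hz hcn]
  have hsh := shift_eq hF hs hx hy
  have hlt : shift n (k - k₀) l x y < n := by
    unfold shift
    split_ifs
    · exact hy
    · exact (Nat.mod_lt _ hs.blocks_pos).trans hs.blocks_lt
  rw [point_ne_zero hP (show opLink ∈ postPlan by simp [postPlan]) hx hy, eval_disj, eval_conj,
    eval_eql, eval_eql, eval_row, Link]
  simp only [Expr.eval, eval_X, eval_row, eval_Y]
  simp only [evalState, hsh, scalar, Expr.eval, h15]
  have hdiv : ∀ a, a / classes n (k - k₀) l ≤ a := fun a => Nat.div_le_self _ _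
  have hrn : rank G (k - k₀) k l (shift n (k - k₀) l x y) < n := by
    refine lt_of_le_of_lt (b := shift n (k - k₀) l x y) ?_ hlt
    refine (Finset.card_le_card (t := Finset.range (shift n (k - k₀) l x y)) ?_).trans (by simp)
    intro z hz
    simp only [Finset.mem_filter, Finset.mem_range] at hz ⊢
    exact hz.2.1
  have hqn : x / blocks n (k - k₀) l < n := (Nat.div_le_self _ _).trans_lt hx
  rw [hS _ hlt 0 hn, h32 x hx, h31 _ hlt, h30 _ hlt, quotient_eq hF hs hx hn,
    mul_eq hF ((hdiv _).trans_lt hqn) hcn, mul_eq hF ((hdiv _).trans_lt hrn) hcn, hmod, hmod]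

end Body

open Classical in
/-- The array `0` at the end, in terms of the table of links. -/
theorem output_eq {n k₀ k l : ℕ} {G : SimpleGraph (Fin n)} {F : Arrays}
    (h0 : ∀ x y, F 0 x y = adjEntry G x y) {x y : ℕ} (hx : x < n) (hy : y < n) :
    applyOps (parameters n k₀ k l) post F 0 x y =
      if Adj G x y ∨ x ≠ y ∧ 0 < k - k₀ ∧ 0 < l ∧
        (applyOps (parameters n k₀ k l) postPlan F 33 x y ≠ 0 ∨
          applyOps (parameters n k₀ k l) postPlan F 33 y x ≠ 0) then 1 else 0 := by
  set F' := applyOps (parameters n k₀ k l) postPlan F with hF'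
  have hpost : applyOps (parameters n k₀ k l) post F =
      opOutput.apply (parameters n k₀ k l) F' := by
    simp only [applyOps, post, List.foldl_append, hF']
    rfl
  have hp : parameters n k₀ k l 0 = n := rfl
  have h0' : ∀ x y, F' 0 x y = adjEntry G x y := by
    intro x y
    rw [hF', applyOps_of_notMem (by decide), h0]
  have hsol : Solves (parameters n k₀ k l) postPlan F' :=
    SingleAssignment.solves postPlan_singleAssignment F
  rw [hpost]
  simp only [TableOp.apply, show opOutput.target = 0 from rfl, hp, hx, hy, true_and, if_true]
  rw [show opOutput.entry (parameters n k₀ k l) F' x y = _ from entry_point hx]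
  have h34 := point_ne_zero hsol (show opNew ∈ postPlan by simp [postPlan]) hx hy
  have : (Expr.cell 34 X Y).eval (evalState (parameters n k₀ k l) F' x y x) ≠ 0 ↔
      Adj G x y ∨ x ≠ y ∧ 0 < k - k₀ ∧ 0 < l ∧ (F' 33 x y ≠ 0 ∨ F' 33 y x ≠ 0) := by
    refine h34.trans ?_
    rw [eval_disj, eval_conj, eval_conj, eval_conj, eval_disj]
    have h1 : (neg (eql X Y)).eval (evalState (parameters n k₀ k l) F' x y x) ≠ 0 ↔ x ≠ y := by
      rw [eval_neg, ← not_iff_not, ← ne_eq, eval_eql, not_not]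
      rfl
    have h2 : (Expr.cell 0 X Y).eval (evalState (parameters n k₀ k l) F' x y x) ≠ 0 ↔ Adj G x y := by
      rw [← adjEntry_ne_zero, ← h0']
      rfl
    have h3 : need.eval (evalState (parameters n k₀ k l) F' x y x) = k - k₀ := rfl
    have h4 : (Expr.reg 3).eval (evalState (parameters n k₀ k l) F' x y x) = l := rfl
    rw [h1, h2, h3, h4, ← Nat.pos_iff_ne_zero, ← Nat.pos_iff_ne_zero]
    rfl
  simp only [this]

end Anonymizer

/-! ### The output graph and the run of the program. -/

namespace Anonymization

/-- The graph that the algorithm constructs. -/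
def output {n : ℕ} (G : SimpleGraph (Fin n)) (m k l : ℕ) : SimpleGraph (Fin n) where
  Adj x y := G.Adj x y ∨ x ≠ y ∧ 0 < m ∧ 0 < l ∧
    (Link G m k l x y ∨ Link G m k l y x)
  symm := ⟨fun x y h => by
    rcases h with h | ⟨h1, h2, h3, h4⟩
    · exact .inl h.symm
    · exact .inr ⟨h1.symm, h2, h3, h4.symm⟩⟩
  loopless := ⟨fun x h => by
    rcases h with h | h
    · exact G.loopless.irrefl x h
    · exact h.1 rfl⟩

end Anonymization

namespace Anonymizer

open Anonymization

theorem adj_coe_iff {n : ℕ} {G : SimpleGraph (Fin n)} {x y : Fin n} :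
    Anonymization.Adj G x y ↔ G.Adj x y :=
  ⟨fun ⟨_, _, h⟩ => h, fun h => ⟨x.2, y.2, h⟩⟩

theorem adjEntry_coe {n : ℕ} {G : SimpleGraph (Fin n)} {x y : Fin n} [Decidable (G.Adj x y)] :
    adjEntry G x y = if G.Adj x y then 1 else 0 := by
  unfold adjEntry
  by_cases h : G.Adj x y
  · rw [if_pos h]
    exact if_pos (adj_coe_iff.2 h)
  · rw [if_neg h]
    exact if_neg (mt adj_coe_iff.1 h)

/-- The program always halts in polynomial time and returns a graph, and it returns the graph
`output G (k - k₀) k l` if the parameters are small. -/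
theorem program_outputs : ∃ K : ℕ, ∀ (n : ℕ) (G : SimpleGraph (Fin n)) (k₀ k l : ℕ) (ω : ℕ → Bool),
    ∃ t ≤ K * (n + 1) ^ 4, ∃ G₁ : SimpleGraph (Fin n), Outputs program G k₀ k l ω t G₁ ∧
      (SmallParameters n k₀ k l → G₁ = output G (k - k₀) k l) := by
  classical
  obtain ⟨K, hK⟩ := program_exec
  refine ⟨K, fun n G k₀ k l ω => ?_⟩
  obtain ⟨s, ⟨t, ht, he⟩, hs⟩ := hK (parameters n k₀ k l) (initialState G k₀ k l ω)
    (fun _ _ => rfl)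
  set F₀ := (initialState G k₀ k l ω).arr with hF₀
  set F₁ := applyOps (parameters n k₀ k l) pre F₀ with hF₁
  set F₂ := (applyOps (parameters n k₀ k l) body)^[n] F₁ with hF₂
  have hs : s.arr = applyOps (parameters n k₀ k l) post F₂ := hs
  have h10 : ∀ x y, F₁ 0 x y = adjEntry G x y := by
    intro x y
    rw [hF₁, applyOps_of_notMem (by decide)]
    rfl
  have h20 : ∀ x y, F₂ 0 x y = adjEntry G x y := by
    have : ∀ t, ((applyOps (parameters n k₀ k l) body)^[t] F₁) 0 = F₁ 0 := by
      intro t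
      induction t with
      | zero => rfl
      | succ t ih => rw [Function.iterate_succ_apply', applyOps_of_notMem (by decide), ih]
    intro x y
    rw [hF₂, this, h10]
  let E : ℕ → ℕ → ℕ := applyOps (parameters n k₀ k l) postPlan F₂ 33
  -- This is symmetric and loopless whatever table `33` contains, so a graph is returned even if the
  -- parameters are too large for the multiplication table.
  let G₁ : SimpleGraph (Fin n) :=
    { Adj := fun x y => G.Adj x y ∨ x ≠ y ∧ 0 < k - k₀ ∧ 0 < l ∧ (E x y ≠ 0 ∨ E y x ≠ 0)
      symm := ⟨fun x y h => by
        rcases h with h | ⟨h1, h2, h3, h4⟩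
        · exact .inl h.symm
        · exact .inr ⟨h1.symm, h2, h3, h4.symm⟩⟩
      loopless := ⟨fun x h => by
        rcases h with h | h
        · exact G.loopless.irrefl x h
        · exact h.1 rfl⟩ }
  refine ⟨t, ht, G₁, ⟨s, he, fun x y => ?_⟩, fun hsm => ?_⟩
  · rw [hs, output_eq h20 x.2 y.2, adjEntry_coe]
    refine if_congr ?_ rfl rfl
    rw [adj_coe_iff, ne_eq, Fin.val_inj]
  · have hpre : Solves (parameters n k₀ k l) pre F₁ :=
      SingleAssignment.solves pre_singleAssignment F₀
    obtain ⟨h1, h2⟩ := loop_spec hpre h10 hsm (fun x y => by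
      rw [hF₁, applyOps_of_notMem (by decide)]
      rfl) n
    have hlt : ∀ a < 21, applyOps (parameters n k₀ k l) postPlan F₂ a = F₂ a := by
      intro a ha
      refine applyOps_of_notMem fun h => ?_
      have : ∀ o ∈ postPlan, 20 < o.target := by decide
      obtain ⟨o, ho, rfl⟩ := List.mem_map.1 h
      have := this o ho
      omega
    have hlink : ∀ x < n, ∀ y < n, E x y ≠ 0 ↔ Link G (k - k₀) k l x y := by
      intro x hx y hy
      refine post_spec (Solves.of_eq_below hpre fun a ha => ?_) hsm
        (SingleAssignment.solves postPlan_singleAssignment F₂) (fun x hx y hy => ?_) hx hy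
      · rw [hlt a (by omega), hF₂, h1 a ha]
      · rw [hlt 20 (by omega)]
        exact h2 x hx y hy
    ext x y
    simp only [G₁, output, hlink x x.2 y y.2, hlink y y.2 x x.2]

end Anonymizer

/-! ### Residue classes in an initial segment -/

theorem le_card_of_residue {n N d e : ℕ} (he : e < N) (hd : N * d ≤ n) :
    d ≤ ((Finset.range n).filter fun u => u % N = e).card := by
  have hinj : Set.InjOn (fun p => e + N * p) (Finset.range d : Set ℕ) := by
    intro p _ p' _ h
    exact Nat.eq_of_mul_eq_mul_left (by omega : 0 < N) (Nat.add_left_cancel h)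
  refine (Finset.card_range d).symm.le.trans ?_
  rw [← Finset.card_image_of_injOn hinj]
  refine Finset.card_le_card fun u hu => ?_
  obtain ⟨p, hp, rfl⟩ := Finset.mem_image.1 hu
  have hp := Finset.mem_range.1 hp
  refine Finset.mem_filter.2 ⟨Finset.mem_range.2 ?_, ?_⟩
  · have := Nat.mul_le_mul_left N (Nat.succ_le_of_lt hp)
    rw [Nat.mul_succ] at this
    omega
  · rw [Nat.add_mul_mod_self_left, Nat.mod_eq_of_lt he]

/-- In mixed radix, the numbers `e + N * (f + J * p)` with `p < d` are such elements. -/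
theorem le_card_of_residue_of_residue {n N J d e f : ℕ} (he : e < N) (hf : f < J)
    (hd : N * (J * d) ≤ n) :
    d ≤ ((Finset.range n).filter fun u => u % N = e ∧ u / N % J = f).card := by
  have hN : 0 < N := by omega
  have hJ : 0 < J := by omega
  have hinj : Set.InjOn (fun p => e + N * (f + J * p)) (Finset.range d : Set ℕ) := by
    intro p _ p' _ h
    have := Nat.eq_of_mul_eq_mul_left hN (Nat.add_left_cancel h)
    exact Nat.eq_of_mul_eq_mul_left hJ (Nat.add_left_cancel this)
  refine (Finset.card_range d).symm.le.trans ?_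
  rw [← Finset.card_image_of_injOn hinj]
  refine Finset.card_le_card fun u hu => ?_
  obtain ⟨p, hp, rfl⟩ := Finset.mem_image.1 hu
  have hp := Finset.mem_range.1 hp
  refine Finset.mem_filter.2 ⟨Finset.mem_range.2 ?_, ?_, ?_⟩
  · have h1 := Nat.mul_le_mul_left J (Nat.succ_le_of_lt hp)
    rw [Nat.mul_succ] at h1
    have h2 := Nat.mul_le_mul_left N (show f + J * p + 1 ≤ J * d by omega)
    rw [Nat.mul_succ] at h2
    omega
  · rw [Nat.add_mul_mod_self_left, Nat.mod_eq_of_lt he]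
  · rw [Nat.add_mul_div_left _ _ hN, Nat.div_eq_of_lt he, zero_add, Nat.add_mul_mod_self_left,
      Nat.mod_eq_of_lt hf]

theorem card_residue_le {n N d e : ℕ} (hd : n ≤ N * d) :
    ((Finset.range n).filter fun u => u % N = e).card ≤ d := by
  have hinj : Set.InjOn (fun u => u / N)
      ((Finset.range n).filter fun u => u % N = e : Finset ℕ) := by
    intro u hu u' hu' h
    have hu := (Finset.mem_filter.1 hu).2
    have hu' := (Finset.mem_filter.1 hu').2
    have h : u / N = u' / N := h
    rw [← Nat.div_add_mod u N, ← Nat.div_add_mod u' N, hu, hu', h]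
  rw [← Finset.card_image_of_injOn hinj]
  refine (Finset.card_le_card (t := Finset.range d) fun u hu => ?_).trans (by simp)
  obtain ⟨w, hw, rfl⟩ := Finset.mem_image.1 hu
  have := Finset.mem_range.1 (Finset.mem_filter.1 hw).1
  exact Finset.mem_range.2 (Nat.div_lt_of_lt_mul (by omega))

/-- Given both residues, `u` is determined by `u / N / J`, which is less than `d`. -/
theorem card_residue_residue_le {n N J d e f : ℕ} (hd : n ≤ N * (J * d)) :
    ((Finset.range n).filter fun u => u % N = e ∧ u / N % J = f).card ≤ d := by
  have hinj : Set.InjOn (fun u => u / N / J)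
      ((Finset.range n).filter fun u => u % N = e ∧ u / N % J = f : Finset ℕ) := by
    intro u hu u' hu' h
    have hu := (Finset.mem_filter.1 hu).2
    have hu' := (Finset.mem_filter.1 hu').2
    have h : u / N / J = u' / N / J := h
    rw [← Nat.div_add_mod u N, ← Nat.div_add_mod u' N, ← Nat.div_add_mod (u / N) J,
      ← Nat.div_add_mod (u' / N) J, hu.1, hu.2, hu'.1, hu'.2, h]
  rw [← Finset.card_image_of_injOn hinj]
  refine (Finset.card_le_card (t := Finset.range d) fun u hu => ?_).trans (by simp)
  obtain ⟨w, hw, rfl⟩ := Finset.mem_image.1 hu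
  have := Finset.mem_range.1 (Finset.mem_filter.1 hw).1
  refine Finset.mem_range.2 (Nat.div_lt_of_lt_mul (Nat.div_lt_of_lt_mul (by omega)))

theorem card_filter_le_mul {A B : Finset ℕ} {f : ℕ → ℕ} {a : ℕ} (P : ℕ → Prop) [DecidablePred P]
    (h : ∀ x ∈ A, P x → f x ∈ B)
    (h' : ∀ c ∈ B, (A.filter fun x => P x ∧ f x = c).card ≤ a) :
    (A.filter P).card ≤ B.card * a := by
  rw [mul_comm]
  refine Finset.card_le_mul_card_image_of_maps_to (f := f) (fun x hx => ?_) a fun c hc => ?_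
  · have := Finset.mem_filter.1 hx
    exact h x this.1 this.2
  · rw [Finset.filter_filter]
    exact h' c hc

namespace Anonymization

/-! ### The parameters of the construction -/

section Parameters

variable {n m k l : ℕ}

theorem size_sub_two_lt_iff {z : ℕ} (hz : z < n) : z + 2 < size n m l ↔ z * z < m * l := by
  unfold size
  rw [add_lt_add_iff_right]
  exact lt_card_filter_iff (P := fun z => z * z < m * l)
    (fun i j hij h => (Nat.mul_le_mul hij hij).trans_lt h) hz

/-- Since `m * l ≤ k * k`, the number `k` already fails the test `z * z < m * l`. -/
theorem size_le (hm : m ≤ k) (hl : l ≤ k) (hk : k < n) : size n m l ≤ k + 2 := by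
  by_contra h
  push Not at h
  have := (size_sub_two_lt_iff hk).1 h
  have := Nat.mul_le_mul hm hl
  omega

theorem two_le_size : 2 ≤ size n m l := by
  unfold size
  omega

/-- The least size of a block exceeds `√(m * l)` by at least `2` and by less than `3`. -/
theorem mul_le_size_sub_sq (hm : m ≤ k) (hl : l ≤ k) (hk : k + 2 < n) :
    m * l ≤ (size n m l - 2) * (size n m l - 2) := by
  have h := size_le (n := n) hm hl (by omega)
  have h2 : 2 ≤ size n m l := two_le_size
  have := (size_sub_two_lt_iff (m := m) (l := l) (z := size n m l - 2) (n := n) (by omega)).not.1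
    (by omega)
  omega

theorem size_sub_sq_lt (hm : m ≤ k) (hl : l ≤ k) (hk : k + 2 < n) (h3 : 2 < size n m l) :
    (size n m l - 3) * (size n m l - 3) < m * l := by
  have h := size_le (n := n) hm hl (by omega)
  exact (size_sub_two_lt_iff (z := size n m l - 3) (n := n) (by omega)).1 (by omega)

/-- For `l > 0` this is `(l - 1) * (l - 1) < m * l`. It guarantees at least one class in each block.
-/
theorem add_two_le_size (h : l ≤ m) (hl : l < n) : l + 2 ≤ size n m l := by
  rcases Nat.eq_zero_or_pos l with rfl | hpos
  · simpa using two_le_size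
  · have := (size_sub_two_lt_iff (m := m) (l := l) (z := l - 1) (n := n) (by omega)).2
      (Nat.mul_lt_mul'' (by omega) (by omega))
    omega

theorem width_pos : 0 < width n m l := by
  have : 2 ≤ size n m l := two_le_size
  unfold width
  split_ifs <;> omega

theorem rounds_le : rounds n m l ≤ m + m := by
  refine (Finset.card_le_card (t := Finset.range (m + m)) fun z hz => ?_).trans (by simp)
  have hz := (Finset.mem_filter.1 hz).2
  exact Finset.mem_range.2 ((Nat.le_mul_of_pos_right z width_pos).trans_lt hz)

theorem lt_rounds_iff {z : ℕ} (hz : z < n) : z < rounds n m l ↔ z * width n m l < m + m :=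
  lt_card_filter_iff (P := fun z => z * width n m l < m + m)
    (fun _ _ hij h => (Nat.mul_le_mul_right _ hij).trans_lt h) hz

/-- `rounds` is `2m / width` rounded up; counting below `n` only does no harm when `m + m < n`. The
factor `2` makes up for good indices that yield only half of `width`. -/
theorem le_rounds_mul (hm : m + m < n) : m + m ≤ rounds n m l * width n m l := by
  have h : rounds n m l ≤ m + m := rounds_le
  have := (lt_rounds_iff (m := m) (l := l) (z := rounds n m l) (n := n) (by omega)).not.1 (by omega)
  omega

theorem rounds_mul_le (hm : m + m < n) : rounds n m l * width n m l ≤ m + m + width n m l := by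
  have h : rounds n m l ≤ m + m := rounds_le
  rcases Nat.eq_zero_or_pos (rounds n m l) with h0 | hpos
  · simp [h0]
  · have := (lt_rounds_iff (m := m) (l := l) (z := rounds n m l - 1) (n := n) (by omega)).1
      (by omega)
    rw [Nat.sub_mul, one_mul] at this
    omega

theorem blocks_mul_le : blocks n m l * size n m l ≤ n := Nat.div_mul_le_self _ _

theorem blocks_pos (hs : size n m l ≤ n) : 0 < blocks n m l :=
  Nat.div_pos hs (by have : 2 ≤ size n m l := two_le_size; omega)

theorem lt_blocks_mul : n < blocks n m l * size n m l + size n m l :=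
  Nat.lt_div_mul_add (by have : 2 ≤ size n m l := two_le_size; omega)

/-- With at least one block, `n < (blocks + 1) * size ≤ 2 * blocks * size`; hence no block exceeds
twice the least size. -/
theorem le_blocks_mul (hs : size n m l ≤ n) : n ≤ blocks n m l * (2 * size n m l) := by
  have h1 := blocks_pos hs
  have h2 : n < blocks n m l * size n m l + size n m l := lt_blocks_mul
  have h3 := Nat.mul_le_mul_right (size n m l) h1
  calc n ≤ blocks n m l * size n m l + blocks n m l * size n m l := by omega
    _ = _ := by ring

variable (n m l) in
/-- The number of indices. -/
def indices : ℕ := if m < l then n else blocks n m l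

theorem indices_le : indices n m l ≤ n := by
  unfold indices
  split_ifs
  · exact le_rfl
  · exact Nat.div_le_self _ _

theorem lt_indices_mul :
    n < indices n m l * width n m l + width n m l := by
  unfold indices width
  split_ifs
  · omega
  · exact lt_blocks_mul

theorem shift_eq_iff {x y c : ℕ} (h : l ≤ m) (hs : size n m l ≤ n) (hc : c < blocks n m l) :
    shift n m l x y = c ↔ y % blocks n m l = (x + c) % blocks n m l := by
  have hb := blocks_pos hs
  unfold shift
  rw [if_neg h.not_gt, ← Nat.mod_add_mod]
  have hx := Nat.mod_lt x hb
  have hy := Nat.mod_lt y hb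
  generalize x % blocks n m l = x' at *
  generalize y % blocks n m l = y' at *
  generalize blocks n m l = b at *
  have h1 : (y' + b - x') % b = if x' ≤ y' then y' - x' else y' + b - x' := by
    split_ifs
    · rw [show y' + b - x' = (y' - x') + b by omega, Nat.add_mod_right, Nat.mod_eq_of_lt (by omega)]
    · rw [Nat.mod_eq_of_lt (by omega)]
  have h2 : (x' + c) % b = if x' + c < b then x' + c else x' + c - b := by
    split_ifs
    · rw [Nat.mod_eq_of_lt (by omega)]
    · rw [Nat.mod_eq_sub_mod (by omega), Nat.mod_eq_of_lt (by omega)]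
  rw [h1, h2]
  split_ifs <;> omega

/-- The same relation solved for `x`, for counting the sources of the links that arrive at `y`. -/
theorem shift_eq_iff' {x y c : ℕ} (h : l ≤ m) (hs : size n m l ≤ n) (hc : c < blocks n m l) :
    shift n m l x y = c ↔ x % blocks n m l = (y + (blocks n m l - c)) % blocks n m l := by
  have hb := blocks_pos hs
  rw [shift_eq_iff h hs hc, ← Nat.mod_add_mod, ← Nat.mod_add_mod y]
  have hx := Nat.mod_lt x hb
  have hy := Nat.mod_lt y hb
  generalize x % blocks n m l = x' at *
  generalize y % blocks n m l = y' at *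
  generalize blocks n m l = b at *
  have h1 : (y' + (b - c)) % b = if c ≤ y' then y' - c else y' + b - c := by
    split_ifs
    · rw [show y' + (b - c) = (y' - c) + b by omega, Nat.add_mod_right, Nat.mod_eq_of_lt (by omega)]
    · rw [Nat.mod_eq_of_lt (by omega)]
      omega
  have h2 : (x' + c) % b = if x' + c < b then x' + c else x' + c - b := by
    split_ifs
    · rw [Nat.mod_eq_of_lt (by omega)]
    · rw [Nat.mod_eq_sub_mod (by omega), Nat.mod_eq_of_lt (by omega)]
  rw [h1, h2]
  split_ifs <;> omega

theorem shift_lt_blocks {x y : ℕ} (h : l ≤ m) (hs : size n m l ≤ n) :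
    shift n m l x y < blocks n m l := by
  unfold shift
  rw [if_neg h.not_gt]
  exact Nat.mod_lt _ (blocks_pos hs)

theorem width_le_card_shift {x c : ℕ} (hs : size n m l ≤ n) (hc : c < indices n m l) :
    width n m l ≤ ((Finset.range n).filter fun z => shift n m l x z = c).card := by
  by_cases h : m < l
  · simp only [indices, width, shift, h, if_true] at hc ⊢
    exact Finset.card_pos.2 ⟨c, Finset.mem_filter.2 ⟨Finset.mem_range.2 hc, rfl⟩⟩
  · simp only [indices, width, h, if_false] at hc ⊢
    simp only [shift_eq_iff (not_lt.1 h) hs hc]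
    exact le_card_of_residue (Nat.mod_lt _ (blocks_pos hs)) blocks_mul_le

theorem card_shift_le {x c : ℕ} (h : l ≤ m) (hs : size n m l ≤ n) (hc : c < blocks n m l) :
    ((Finset.range n).filter fun y => shift n m l x y = c).card ≤ 2 * size n m l := by
  simp only [shift_eq_iff h hs hc]
  exact card_residue_le (le_blocks_mul hs)

theorem card_shift_le' {y c : ℕ} (h : l ≤ m) (hs : size n m l ≤ n) (hc : c < blocks n m l) :
    ((Finset.range n).filter fun x => shift n m l x y = c).card ≤ 2 * size n m l := by
  simp only [shift_eq_iff' h hs hc]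
  exact card_residue_le (le_blocks_mul hs)

end Parameters

end Anonymization

/-! ### New partners and the anonymity of the output. -/

theorem Finset.sum_card_fiber {n : ℕ} (T : Finset ℕ) (P : ℕ → Prop) [DecidablePred P] (f : ℕ → ℕ) :
    ∑ c ∈ T, ((Finset.range n).filter fun z => P z ∧ f z = c).card =
      ((Finset.range n).filter fun z => P z ∧ f z ∈ T).card := by
  rw [Finset.card_eq_sum_card_fiberwise (f := f) (t := T)
    (fun z hz => (Finset.mem_filter.1 hz).2.2)]
  refine Finset.sum_congr rfl fun c hc => ?_
  rw [Finset.filter_filter]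
  congr 1
  ext z
  simp only [Finset.mem_filter]
  constructor
  · rintro ⟨h1, h2, rfl⟩
    exact ⟨h1, ⟨h2, hc⟩, rfl⟩
  · rintro ⟨h1, ⟨h2, -⟩, h3⟩
    exact ⟨h1, h2, h3⟩

namespace Anonymization

variable {n m k l : ℕ} {G : SimpleGraph (Fin n)}

theorem Adj.symm {x y : ℕ} (h : Adj G x y) : Adj G y x :=
  let ⟨hx, hy, h⟩ := h
  ⟨hy, hx, h.symm⟩

theorem adj_comm {x y : ℕ} : Adj G x y ↔ Adj G y x := ⟨Adj.symm, Adj.symm⟩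

theorem Adj.mono {H : SimpleGraph (Fin n)} (hG : G ≤ H) {x y : ℕ} (h : Adj G x y) : Adj H x y :=
  let ⟨hx, hy, h⟩ := h
  ⟨hx, hy, hG h⟩

theorem common_comm (x y : ℕ) : common G x y = common G y x := by
  refine Finset.card_filter_congr' fun z _ => ?_
  rw [adj_comm (x := x), adj_comm (y := y), and_comm]

theorem card_filter_range {P : ℕ → Prop} {_ : DecidablePred P} :
    ((Finset.range n).filter P).card = {z : Fin n | P z}.ncard := by
  rw [← Set.ncard_image_of_injective {z : Fin n | P z} Fin.val_injective, ← Set.ncard_coe_finset]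
  congr 1
  ext z
  simp only [Finset.coe_filter, Finset.mem_range, Set.mem_ofPred_eq, Set.mem_image]
  constructor
  · rintro ⟨hz, h⟩
    exact ⟨⟨z, hz⟩, h, rfl⟩
  · rintro ⟨w, h, rfl⟩
    exact ⟨w.2, h⟩

theorem ncard_commonNeighbors (u v : Fin n) : (G.commonNeighbors u v).ncard = common G u v := by
  rw [common, card_filter_range]
  congr 1
  ext z
  simp only [SimpleGraph.mem_commonNeighbors, Set.mem_ofPred_eq, Anonymizer.adj_coe_iff,
    G.adj_comm z v]

open Classical in
theorem isAnonymous_iff : IsAnonymous G k l ↔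
    ∀ x < n, k ≤ ((Finset.range n).filter fun z => Partner G l x z).card := by
  have key : ∀ x u : Fin n, Partner G l x u ↔ u ≠ x ∧ l ≤ (G.commonNeighbors u x).ncard := by
    intro x u
    rw [Partner, ncard_commonNeighbors, common_comm u x, ne_comm, ne_eq, ne_eq, Fin.val_inj]
  constructor
  · intro h x hx
    obtain ⟨U, hU, hk, hp⟩ := h ⟨x, hx⟩
    rw [card_filter_range]
    refine hk.trans ?_
    rw [← Set.ncard_coe_finset]
    refine Set.ncard_le_ncard (fun u hu => ?_) (Set.toFinite _)
    exact (key ⟨x, hx⟩ u).2 ⟨fun he => hU (he ▸ hu), hp u hu⟩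
  · intro h v
    have := h v v.2
    rw [card_filter_range] at this
    refine ⟨Finset.univ.filter fun u => Partner G l v u, ?_, ?_, ?_⟩
    · intro hv
      exact (Finset.mem_filter.1 hv).2.1 rfl
    · rw [← Set.ncard_coe_finset]
      simpa using this
    · intro u hu
      exact ((key v u).1 (Finset.mem_filter.1 hu).2).2

theorem Partner.mono {H : SimpleGraph (Fin n)} (hG : G ≤ H) {x y : ℕ} (h : Partner G l x y) :
    Partner H l x y := by
  classical
  refine ⟨h.1, h.2.trans (Finset.card_le_card fun z hz => ?_)⟩
  have hz := Finset.mem_filter.1 hz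
  exact Finset.mem_filter.2 ⟨hz.1, hz.2.1.mono hG, hz.2.2.mono hG⟩

-- There are three sources of bad vertices: `x` itself, its fewer than `k` partners, and its
-- neighbours, which count only if there are at most `l` of them. Altogether at most `1 + (k - 1) +
-- l`.
open Classical in
theorem card_bad_le {x : ℕ} (hx : Client G k l x) (hl : l ≤ k) :
    ((Finset.range n).filter fun z => Bad G l x z).card ≤ 2 * k := by
  set A := (Finset.range n).filter fun z => Partner G l x z with hA
  set B := (Finset.range n).filter fun z => Adj G x z ∧ degree G x ≤ l with hB
  have hBl : B.card ≤ l := by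
    by_cases h : degree G x ≤ l
    · simp only [hB, h, and_true]
      exact h
    · simp [hB, h]
  have hsub : (Finset.range n).filter (fun z => Bad G l x z) ⊆ insert x (A ∪ B) := by
    intro z hz
    obtain ⟨hz, rfl | h | h⟩ := Finset.mem_filter.1 hz
    · simp
    · simp [hA, Finset.mem_range.1 hz, h]
    · simp [hB, Finset.mem_range.1 hz, h]
  have h1 := Finset.card_le_card hsub
  have h2 := Finset.card_insert_le x (A ∪ B)
  have h3 := Finset.card_union_le A B
  have h4 : A.card < k := hx
  omega

/-- An index reaches at least `width` vertices; if it is not good, at least `width / 2` of these are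
bad. Different indices reach disjoint sets, and at most `2 * k` vertices are bad. -/
theorem card_not_good_mul_le {x : ℕ} (hx : Client G k l x) (hl : l ≤ k) (hs : size n m l ≤ n)
    {B : Finset ℕ} (hB : ∀ c ∈ B, c < indices n m l ∧ ¬ Good G m l x c) :
    B.card * width n m l ≤ 4 * k := by
  classical
  have h1 : ∀ c ∈ B, width n m l ≤
      2 * ((Finset.range n).filter fun z => Bad G l x z ∧ shift n m l x z = c).card := by
    intro c hc
    obtain ⟨hc, hg⟩ := hB c hc
    have h := width_le_card_shift (x := x) hs hc
    rw [← Finset.card_filter_add_card_filter_not (fun z => Bad G l x z), Finset.filter_filter,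
      Finset.filter_filter] at h
    have e1 : ((Finset.range n).filter fun z => shift n m l x z = c ∧ Bad G l x z).card =
        ((Finset.range n).filter fun z => Bad G l x z ∧ shift n m l x z = c).card :=
      Finset.card_filter_congr' fun z _ => and_comm
    have e2 : ((Finset.range n).filter fun z => shift n m l x z = c ∧ ¬ Bad G l x z).card =
        gain G m l x c := Finset.card_filter_congr' fun z _ => and_comm
    unfold Good at hg
    omega
  have h2 := Finset.sum_le_sum h1
  rw [Finset.sum_const, smul_eq_mul, ← Finset.mul_sum, Finset.sum_card_fiber] at h2
  have h3 : ((Finset.range n).filter fun z => Bad G l x z ∧ shift n m l x z ∈ B).card ≤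
      ((Finset.range n).filter fun z => Bad G l x z).card :=
    Finset.card_le_card fun z hz => by
      simp only [Finset.mem_filter] at hz ⊢
      exact ⟨hz.1, hz.2.1⟩
  have h4 := card_bad_le hx hl
  omega

variable (n m k l) in
/-- The conditions on the parameters under which the construction works. -/
structure Sparse (D C : ℕ) : Prop where
  m_pos : 0 < m
  l_pos : 0 < l
  m_le : m ≤ k
  l_le : l ≤ k
  two_le : 2 ≤ D
  C_pos : 0 < C
  lt_pow : n < D ^ C
  le : 200 * (C * D * k) ≤ n

namespace Sparse

variable {D C : ℕ} (h : Sparse n m k l D C)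

include h

theorem le_mul : D * k ≤ C * D * k ∧ C * k ≤ C * D * k ∧ k ≤ C * D * k := by
  have h1 := h.C_pos
  have h2 := h.two_le
  refine ⟨?_, ?_, ?_⟩
  · rw [mul_assoc]
    exact Nat.le_mul_of_pos_left _ h1
  · exact Nat.mul_le_mul_right _ (Nat.le_mul_of_pos_right _ (by omega))
  · exact Nat.le_mul_of_pos_left _ (Nat.mul_pos h1 (by omega))

theorem k_le : 200 * k ≤ n := by
  have h1 := h.le_mul
  have h2 := h.le
  omega

theorem k_pos : 0 < k := by
  have := h.m_pos
  have := h.m_le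
  omega

theorem size_le : size n m l ≤ 3 * k := by
  have h1 := h.k_le
  have h2 := h.k_pos
  have := Anonymization.size_le (n := n) h.m_le h.l_le (by omega)
  omega

theorem size_le' : size n m l ≤ n := by
  have h1 := h.k_le
  have h2 := h.size_le
  omega

theorem width_le : width n m l ≤ 3 * k := by
  have h1 := h.k_pos
  have h2 := h.size_le
  unfold width
  split_ifs <;> omega

theorem m_lt : m + m < n := by
  have h1 := h.k_le
  have h2 := h.m_le
  have h3 := h.k_pos
  omega

theorem chosen_spec : chosen G m k l ⊆ Finset.range n ∧
    (chosen G m k l).card ≤ C * rounds n m l ∧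
    ∀ v < n, Client G k l v →
      rounds n m l ≤ Greedy.covered n (Good G m l) (chosen G m k l) v := by
  have hw : 0 < width n m l := width_pos
  refine Greedy.chosen_spec (N := indices n m l) (D := D) (β := 4 * k / width n m l) h.two_le
    indices_le h.lt_pow (rounds_le.trans h.m_lt.le) (fun v _ hc B hB => ?_) ?_
  · rw [Nat.le_div_iff_mul_le hw]
    exact card_not_good_mul_le hc h.l_le h.size_le' hB
  -- Multiplied by `width`, the left side is at most `4Dk + C(2m + width) ≤ 4Dk + 5Ck`, while the
  -- right side exceeds `n - width ≥ n - 3k`. The bound `200CDk ≤ n` leaves ample room.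
  · by_contra hcon
    push Not at hcon
    have h1 := Nat.mul_le_mul_right (width n m l) hcon
    have h2 : n < indices n m l * width n m l + width n m l := lt_indices_mul
    have h3 := Nat.mul_le_mul_left D (Nat.div_mul_le_self (4 * k) (width n m l))
    have h4 := Nat.mul_le_mul_left C (rounds_mul_le (l := l) h.m_lt)
    have h5 := h.width_le
    have h6 := h.m_le
    have h7 : C * (m + m + width n m l) ≤ C * (5 * k) := Nat.mul_le_mul_left C (by omega)
    have h8 := h.le_mul
    have h9 := h.le
    have h10 := h.k_pos
    have e1 : D * (4 * k) = 4 * (D * k) := by ring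
    have e2 : C * (5 * k) = 5 * (C * k) := by ring
    rw [add_mul, mul_assoc, mul_assoc] at h1
    omega

open Classical in
/-- A vertex that needs more partners gets `m` new ones. -/
theorem le_card_new {v : ℕ} (hv : v < n) (hc : Client G k l v) :
    m ≤ ((Finset.range n).filter fun z => ¬ Bad G l v z ∧
      shift n m l v z ∈ chosen G m k l).card := by
  set T := (Finset.range n).filter fun c => c ∈ chosen G m k l ∧ Good G m l v c with hT
  have h1 : rounds n m l ≤ T.card := h.chosen_spec.2.2 v hv hc
  have h2 : ∀ c ∈ T, width n m l ≤
      2 * ((Finset.range n).filter fun z => ¬ Bad G l v z ∧ shift n m l v z = c).card := by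
    intro c hc
    have hg := (Finset.mem_filter.1 hc).2.2
    unfold Good gain at hg
    omega
  have h3 := Finset.sum_le_sum h2
  rw [Finset.sum_const, smul_eq_mul, ← Finset.mul_sum, Finset.sum_card_fiber] at h3
  have h4 : ((Finset.range n).filter fun z => ¬ Bad G l v z ∧ shift n m l v z ∈ T).card ≤
      ((Finset.range n).filter fun z => ¬ Bad G l v z ∧ shift n m l v z ∈ chosen G m k l).card :=
    Finset.card_le_card fun z hz => by
      simp only [Finset.mem_filter, hT] at hz ⊢
      exact ⟨hz.1, hz.2.1, hz.2.2.2.1⟩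
  have h5 := le_rounds_mul (l := l) h.m_lt
  have h6 := Nat.mul_le_mul_right (width n m l) h1
  omega

theorem adj_output {x y : ℕ} (hx : x < n) (hy : y < n) (hxy : x ≠ y)
    (hl : Link G m k l x y ∨ Link G m k l y x) : Adj (output G m k l) x y :=
  ⟨hx, hy, .inr ⟨fun he => hxy (congrArg Fin.val he), h.m_pos, h.l_pos, hl⟩⟩

/-- In the construction with hubs, a new partner `u` of `v` is joined to the neighbours of `v`. -/
theorem partner_output_of_lt (hlt : m < l) {u v : ℕ} (hu : u < n) (hb : ¬ Bad G l v u)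
    (hs : shift n m l v u ∈ chosen G m k l) (hd : l ≤ degree G v) :
    Partner (output G m k l) l v u := by
  classical
  have hvu : v ≠ u := fun he => hb (.inl he)
  refine ⟨hvu, ?_⟩
  have hlink : ∀ w, Link G m k l w u := by
    intro w
    right
    simp only [shift, hlt, if_true] at hs ⊢
    exact ⟨hs, by simp [classes, hlt, Nat.mod_one]⟩
  -- The hub `u` is removed because it is not joined to itself. If it is a neighbour of `v`, then
  -- `v` has more than `l` neighbours, since otherwise `u` would be bad.
  set A := ((Finset.range n).filter fun z => Adj G v z).erase u with hA
  have h1 : l ≤ A.card := by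
    by_cases hadj : Adj G v u
    · rw [hA, Finset.card_erase_of_mem (Finset.mem_filter.2 ⟨Finset.mem_range.2 hu, hadj⟩)]
      have : ¬ degree G v ≤ l := fun hd' => hb (.inr (.inr ⟨hadj, hd'⟩))
      change l ≤ degree G v - 1
      omega
    · rw [hA, Finset.erase_eq_of_notMem fun hm => hadj (Finset.mem_filter.1 hm).2]
      exact hd
  refine h1.trans (Finset.card_le_card fun z hz => ?_)
  obtain ⟨hzu, hz⟩ := Finset.mem_erase.1 hz
  obtain ⟨hzn, hadj⟩ := Finset.mem_filter.1 hz
  exact Finset.mem_filter.2 ⟨hzn, hadj.mono fun _ _ => Or.inl,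
    h.adj_output (Finset.mem_range.1 hzn) hu hzu (.inl (hlink z))⟩

theorem classes_pos : 0 < classes n m l := by
  unfold classes
  split_ifs with hlt
  · exact one_pos
  · have h1 := h.k_le
    have h2 := h.l_le
    have h3 := h.k_pos
    exact Nat.div_pos (add_two_le_size (not_lt.1 hlt) (by omega)) (by omega)

/-- In the construction with blocks, the block of `v` contains enough vertices that are joined to
`v` and to the new partner `u` of `v`. -/
theorem partner_output_of_le (hle : l ≤ m) {u v : ℕ} (hu : u < n) (hv : v < n) (hvu : v ≠ u)
    (hs : shift n m l v u ∈ chosen G m k l) : Partner (output G m k l) l v u := by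
  classical
  refine ⟨hvu, ?_⟩
  have hsz := h.size_le'
  have hb : 0 < blocks n m l := blocks_pos hsz
  set A := (Finset.range n).filter fun w => w % blocks n m l = v % blocks n m l ∧
    w / blocks n m l % classes n m l =
      rank G m k l (shift n m l v u) % classes n m l with hA
  -- The class `A` lies in the block of `v`, so it is joined to `v` by shift `0` and to `u` by the
  -- chosen shift. It may contain `u` or `v`; hence the surplus of `2`.
  have h1 : l + 2 ≤ A.card := by
    refine le_card_of_residue_of_residue (Nat.mod_lt _ hb) (Nat.mod_lt _ h.classes_pos) ?_
    refine le_trans (Nat.mul_le_mul_left _ ?_) blocks_mul_le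
    rw [classes, if_neg hle.not_gt]
    exact Nat.div_mul_le_self _ _
  have h2 : (A \ {u, v}).card + 2 ≥ A.card := by
    have h3 := Finset.le_card_sdiff {u, v} A
    have h4 := Finset.card_le_two (a := u) (b := v)
    omega
  refine le_trans (b := (A \ {u, v}).card) (by omega) (Finset.card_le_card fun w hw => ?_)
  obtain ⟨hw, hne⟩ := Finset.mem_sdiff.1 hw
  simp only [Finset.mem_insert, Finset.mem_singleton, not_or] at hne
  obtain ⟨hwn, hres, hcl⟩ := Finset.mem_filter.1 hw
  have hwn' := Finset.mem_range.1 hwn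
  refine Finset.mem_filter.2 ⟨hwn, h.adj_output hv hwn' (Ne.symm hne.2) (.inl (.inl ?_)),
    h.adj_output hwn' hu hne.1 (.inl (.inr ?_))⟩
  · rw [shift_eq_iff hle hsz hb, hres, add_zero]
  · have : shift n m l w u = shift n m l v u := by
      unfold shift
      rw [hres]
    rw [this]
    exact ⟨hs, hcl⟩

/-- The constructed graph is anonymous. -/
theorem isAnonymous_output {k₀ : ℕ} (hk : k ≤ k₀ + m) (hk₀ : m < l → 0 < k₀)
    (hG : IsAnonymous G k₀ l) : IsAnonymous (output G m k l) k l := by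
  classical
  rw [isAnonymous_iff] at hG ⊢
  intro v hv
  have hle : G ≤ output G m k l := fun _ _ => Or.inl
  have hold : ((Finset.range n).filter fun z => Partner G l v z) ⊆
      (Finset.range n).filter fun z => Partner (output G m k l) l v z := fun z hz => by
    simp only [Finset.mem_filter] at hz ⊢
    exact ⟨hz.1, hz.2.mono hle⟩
  by_cases hc : Client G k l v
  · have h1 := h.le_card_new hv hc
    set A := (Finset.range n).filter fun z => Partner G l v z with hA
    set B := (Finset.range n).filter fun z => ¬ Bad G l v z ∧
      shift n m l v z ∈ chosen G m k l with hB
    have hk₀' : k₀ ≤ A.card := hG v hv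
    have hdis : Disjoint A B := by
      rw [Finset.disjoint_left]
      intro z hz hz'
      exact (Finset.mem_filter.1 hz').2.1 (.inr (.inl (Finset.mem_filter.1 hz).2))
    have hunion := Finset.card_union_of_disjoint hdis
    refine le_trans (b := (A ∪ B).card) (by omega)
      (Finset.card_le_card (Finset.union_subset hold fun u hu => ?_))
    obtain ⟨hun, hbad, hs⟩ := Finset.mem_filter.1 hu
    have hun' := Finset.mem_range.1 hun
    refine Finset.mem_filter.2 ⟨hun, ?_⟩
    rcases lt_or_ge m l with hlt | hge
    · refine h.partner_output_of_lt hlt hun' hbad hs ?_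
      have := hk₀ hlt
      -- An old partner shares `l` neighbours with `v`, so `v` has degree at least `l`.
      obtain ⟨w, hw⟩ := Finset.card_pos.1 (show 0 < A.card by omega)
      refine (Finset.mem_filter.1 hw).2.2.trans (Finset.card_le_card fun z hz => ?_)
      have hz := Finset.mem_filter.1 hz
      exact Finset.mem_filter.2 ⟨hz.1, hz.2.1⟩
    · exact h.partner_output_of_le hge hun' hv (fun he => hbad (.inl he)) hs
  · exact (not_lt.1 hc).trans (Finset.card_le_card hold)

end Sparse

end Anonymization

namespace Anonymization

variable {n m k l : ℕ} {G : SimpleGraph (Fin n)}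

/-! ### The number of added edges -/

theorem rank_lt_card {c : ℕ} (hc : c ∈ chosen G m k l) : rank G m k l c < (chosen G m k l).card := by
  classical
  refine Finset.card_lt_card ((Finset.ssubset_iff_of_subset fun z hz => ?_).2 ⟨c, hc, ?_⟩)
  · exact (Finset.mem_filter.1 hz).2.2
  · intro h
    exact lt_irrefl c (Finset.mem_filter.1 h).2.1

theorem rank_lt_rank {c c' : ℕ} (hc : c ∈ chosen G m k l) (hn : c < n) (h : c < c') :
    rank G m k l c < rank G m k l c' := by
  classical
  refine Finset.card_lt_card ((Finset.ssubset_iff_of_subset fun z hz => ?_).2 ⟨c, ?_, ?_⟩)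
  · simp only [Finset.mem_filter] at hz ⊢
    exact ⟨hz.1, hz.2.1.trans h, hz.2.2⟩
  · exact Finset.mem_filter.2 ⟨Finset.mem_range.2 hn, h, hc⟩
  · intro h
    exact lt_irrefl c (Finset.mem_filter.1 h).2.1

/-- The ranks number the chosen indices without gaps and are therefore evenly distributed modulo
`J`. The indices themselves need not be, which is why classes are assigned by rank. -/
theorem card_rank_le (hS : chosen G m k l ⊆ Finset.range n) {J : ℕ} (hJ : 0 < J) (e : ℕ) :
    ((chosen G m k l).filter fun c => rank G m k l c % J = e).card ≤
      (chosen G m k l).card / J + 1 := by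
  have hinj : Set.InjOn (rank G m k l)
      ((chosen G m k l).filter fun c => rank G m k l c % J = e : Finset ℕ) := by
    intro c hc c' hc' h
    have hc := (Finset.mem_filter.1 hc).1
    have hc' := (Finset.mem_filter.1 hc').1
    rcases lt_trichotomy c c' with hlt | he | hlt
    · exact absurd h (rank_lt_rank hc (Finset.mem_range.1 (hS hc)) hlt).ne
    · exact he
    · exact absurd h (rank_lt_rank hc' (Finset.mem_range.1 (hS hc')) hlt).ne'
  rw [← Finset.card_image_of_injOn hinj]
  refine (Finset.card_le_card fun r hr => ?_).trans
    (card_residue_le (n := (chosen G m k l).card) (N := J) (e := e)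
      (d := (chosen G m k l).card / J + 1) ?_)
  · obtain ⟨c, hc, rfl⟩ := Finset.mem_image.1 hr
    have hc := Finset.mem_filter.1 hc
    exact Finset.mem_filter.2 ⟨Finset.mem_range.2 (rank_lt_card hc.1), hc.2⟩
  · have := Nat.lt_mul_div_succ (chosen G m k l).card hJ
    exact this.le

-- Outgoing links: apart from its own block, `x` is joined to whole blocks, but only for the indices
-- assigned to its class, about one in `classes` of the chosen ones.
open Classical in
theorem card_link_le (h : l ≤ m) (hs : size n m l ≤ n) (hS : chosen G m k l ⊆ Finset.range n)
    (hJ : 0 < classes n m l) (x : ℕ) :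
    ((Finset.range n).filter fun y => Link G m k l x y).card ≤
      2 * size n m l + ((chosen G m k l).card / classes n m l + 1) * (2 * size n m l) := by
  set P : ℕ → Prop := fun y => shift n m l x y ∈ chosen G m k l ∧
    x / blocks n m l % classes n m l =
      rank G m k l (shift n m l x y) % classes n m l with hP
  have h1 : ((Finset.range n).filter fun y => Link G m k l x y).card ≤
      ((Finset.range n).filter fun y => shift n m l x y = 0).card +
        ((Finset.range n).filter P).card := by
    refine le_trans (Finset.card_le_card fun y hy => ?_) (Finset.card_union_le _ _)
    simp only [Finset.mem_union, Finset.mem_filter] at hy ⊢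
    exact hy.2.imp (fun h => ⟨hy.1, h⟩) fun h => ⟨hy.1, h⟩
  have h2 := card_shift_le (x := x) h hs (blocks_pos hs)
  have h3 := card_rank_le hS hJ (x / blocks n m l % classes n m l)
  have h4 := card_filter_le_mul (A := Finset.range n) (f := shift n m l x) (a := 2 * size n m l) P
    (B := (chosen G m k l).filter fun c => rank G m k l c % classes n m l =
      x / blocks n m l % classes n m l)
    (fun y _ hy => Finset.mem_filter.2 ⟨hy.1, hy.2.symm⟩) fun c _ => by
      by_cases hc : c < blocks n m l
      · refine le_trans (Finset.card_le_card fun y hy => ?_) (card_shift_le (x := x) h hs hc)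
        simp only [Finset.mem_filter] at hy ⊢
        exact ⟨hy.1, hy.2.2⟩
      · rw [Finset.filter_eq_empty_iff.2]
        · simp
        · rintro y - ⟨-, rfl⟩
          exact hc (shift_lt_blocks h hs)
  have h5 := Nat.mul_le_mul_right (2 * size n m l) h3
  omega

-- Incoming links: apart from its own block, every chosen index contributes, but only one class of a
-- single block.
open Classical in
theorem card_link_le' (h : l ≤ m) (hs : size n m l ≤ n) (hJ : 0 < classes n m l) (y : ℕ) :
    ((Finset.range n).filter fun x => Link G m k l x y).card ≤
      2 * size n m l + (chosen G m k l).card * (2 * size n m l / classes n m l + 1) := by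
  set P : ℕ → Prop := fun x => shift n m l x y ∈ chosen G m k l ∧
    x / blocks n m l % classes n m l =
      rank G m k l (shift n m l x y) % classes n m l with hP
  have h1 : ((Finset.range n).filter fun x => Link G m k l x y).card ≤
      ((Finset.range n).filter fun x => shift n m l x y = 0).card +
        ((Finset.range n).filter P).card := by
    refine le_trans (Finset.card_le_card fun y hy => ?_) (Finset.card_union_le _ _)
    simp only [Finset.mem_union, Finset.mem_filter] at hy ⊢
    exact hy.2.imp (fun h => ⟨hy.1, h⟩) fun h => ⟨hy.1, h⟩
  have h2 := card_shift_le' (y := y) h hs (blocks_pos hs)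
  have h4 := card_filter_le_mul (A := Finset.range n) (f := fun x => shift n m l x y)
    (a := 2 * size n m l / classes n m l + 1) P (B := chosen G m k l)
    (fun x _ hx => hx.1) fun c _ => by
      by_cases hc : c < blocks n m l
      · refine le_trans (Finset.card_le_card (t := (Finset.range n).filter fun x =>
          x % blocks n m l = (y + (blocks n m l - c)) % blocks n m l ∧
          x / blocks n m l % classes n m l = rank G m k l c % classes n m l) fun x hx => ?_)
          (card_residue_residue_le ?_)
        · obtain ⟨hx, hx', hx''⟩ := Finset.mem_filter.1 hx
          refine Finset.mem_filter.2 ⟨hx, (shift_eq_iff' h hs hc).1 hx'', ?_⟩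
          rw [← hx'']
          exact hx'.2
        · exact (le_blocks_mul hs).trans
            (Nat.mul_le_mul_left _ (Nat.lt_mul_div_succ (2 * size n m l) hJ).le)
      · rw [Finset.filter_eq_empty_iff.2]
        · simp
        · rintro x - ⟨-, rfl⟩
          exact hc (shift_lt_blocks h hs)
  omega

theorem le_sqrt_mul (hlt : m ≤ l) : (m : ℝ) ≤ √((m : ℝ) * l) := by
  refine Real.le_sqrt_of_sq_le ?_
  rw [sq]
  exact_mod_cast Nat.mul_le_mul_left m hlt

namespace Sparse

variable {D C : ℕ} (h : Sparse n m k l D C)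

include h

-- Links lead only to hubs and, since shift `0` is now the vertex `0`, to that vertex. There are at
-- most `C * 2m` hubs, and the extra `1` is absorbed by another `C * m`.
open Classical in
theorem card_link_le_of_lt (hlt : m < l) (x : ℕ) :
    ((Finset.range n).filter fun y => Link G m k l x y).card ≤ 3 * C * m := by
  have h1 : (Finset.range n).filter (fun y => Link G m k l x y) ⊆ insert 0 (chosen G m k l) := by
    intro y hy
    have hy := (Finset.mem_filter.1 hy).2
    simp only [Link, shift, hlt, if_true] at hy
    exact Finset.mem_insert.2 (hy.imp id fun h => h.1)
  have h2 := Finset.card_le_card h1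
  have h3 := Finset.card_insert_le 0 (chosen G m k l)
  have h4 := (h.chosen_spec (G := G)).2.1
  have h5 := Nat.mul_le_mul_left C (rounds_le (n := n) (m := m) (l := l))
  have h6 := Nat.mul_pos h.C_pos h.m_pos
  rw [mul_assoc]
  rw [mul_add] at h5
  omega

/-- The relations between the parameters of the construction with blocks. -/
theorem block_bounds (hle : l ≤ m) :
    rounds n m l ≤ 30 * classes n m l ∧ 2 * size n m l ≤ classes n m l * (12 * l) ∧
      rounds n m l * l ≤ 5 * size n m l := by
  have hk := h.k_le
  have hkp := h.k_pos
  have hmk := h.m_le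
  have hlk := h.l_le
  have hm := h.m_pos
  have hl := h.l_pos
  have h1 : size n m l ≤ m + 2 := Anonymization.size_le le_rfl hle (by omega)
  have h2 : m * l ≤ (size n m l - 2) * (size n m l - 2) := mul_le_size_sub_sq hmk hlk (by omega)
  have h3 : m * l ≤ size n m l * size n m l :=
    h2.trans (Nat.mul_le_mul (Nat.sub_le _ _) (Nat.sub_le _ _))
  have h4 : rounds n m l * size n m l ≤ 5 * m := by
    have := rounds_mul_le (l := l) h.m_lt
    rw [show width n m l = size n m l from if_neg hle.not_gt] at this
    omega
  have h5 : size n m l < size n m l / (l + 2) * (l + 2) + (l + 2) :=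
    Nat.lt_div_mul_add (by omega)
  have hJ := h.classes_pos
  rw [show size n m l / (l + 2) = classes n m l from (if_neg hle.not_gt).symm] at h5
  have h6 := Nat.mul_le_mul_right (l + 2) hJ
  have h7 := Nat.mul_le_mul_left (classes n m l) (show l + 2 ≤ 3 * l by omega)
  have h8 : classes n m l * (3 * l) = 3 * (classes n m l * l) := by ring
  have h9 : classes n m l * (12 * l) = 12 * (classes n m l * l) := by ring
  have h10 : size n m l ≤ 6 * (classes n m l * l) := by omega
  have hs : 0 < size n m l := by
    have : 2 ≤ size n m l := two_le_size
    omega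
  refine ⟨?_, by omega, ?_⟩
  -- Multiply by `m * l ≤ size * size` and give one factor `size` to `rounds * size ≤ 5 * m`, the
  -- other to `size ≤ 6 * classes * l`.
  · refine Nat.le_of_mul_le_mul_right ?_ (Nat.mul_pos hm hl)
    calc rounds n m l * (m * l) ≤ rounds n m l * (size n m l * size n m l) :=
          Nat.mul_le_mul_left _ h3
      _ = rounds n m l * size n m l * size n m l := by ring
      _ ≤ 5 * m * (6 * (classes n m l * l)) := Nat.mul_le_mul h4 h10
      _ = 30 * classes n m l * (m * l) := by ring
  · refine Nat.le_of_mul_le_mul_right ?_ hs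
    calc rounds n m l * l * size n m l = rounds n m l * size n m l * l := by ring
      _ ≤ 5 * m * l := Nat.mul_le_mul_right _ h4
      _ = 5 * (m * l) := by ring
      _ ≤ 5 * (size n m l * size n m l) := Nat.mul_le_mul_left _ h3
      _ = 5 * size n m l * size n m l := by ring

open Classical in
theorem card_link_le (hle : l ≤ m) (x : ℕ) :
    ((Finset.range n).filter fun y => Link G m k l x y).card ≤ 64 * C * size n m l := by
  obtain ⟨h1, -, -⟩ := h.block_bounds hle
  obtain ⟨hS, hc, -⟩ := h.chosen_spec (G := G)
  refine (Anonymization.card_link_le hle h.size_le' hS h.classes_pos x).trans ?_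
  have h2 : (chosen G m k l).card / classes n m l ≤ 30 * C := by
    refine Nat.div_le_of_le_mul (hc.trans ((Nat.mul_le_mul_left C h1).trans_eq ?_))
    ring
  have hC := h.C_pos
  calc 2 * size n m l + ((chosen G m k l).card / classes n m l + 1) * (2 * size n m l)
      ≤ 2 * size n m l + (30 * C + 1) * (2 * size n m l) := by gcongr
    _ = (60 * C + 4) * size n m l := by ring
    _ ≤ 64 * C * size n m l := Nat.mul_le_mul_right _ (by omega)

open Classical in
theorem card_link_le' (hle : l ≤ m) (y : ℕ) :
    ((Finset.range n).filter fun x => Link G m k l x y).card ≤ 67 * C * size n m l := by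
  obtain ⟨-, h1, h2⟩ := h.block_bounds hle
  obtain ⟨hS, hc, -⟩ := h.chosen_spec (G := G)
  refine (Anonymization.card_link_le' hle h.size_le' h.classes_pos y).trans ?_
  have h3 : 2 * size n m l / classes n m l ≤ 12 * l := Nat.div_le_of_le_mul h1
  have hC := h.C_pos
  have hl := h.l_pos
  calc 2 * size n m l + (chosen G m k l).card * (2 * size n m l / classes n m l + 1)
      ≤ 2 * size n m l + C * rounds n m l * (13 * l) := by gcongr; omega
    _ = 2 * size n m l + 13 * C * (rounds n m l * l) := by ring
    _ ≤ 2 * size n m l + 13 * C * (5 * size n m l) := by gcongr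
    _ = (65 * C + 2) * size n m l := by ring
    _ ≤ 67 * C * size n m l := Nat.mul_le_mul_right _ (by omega)

/-- `size` is at most `√(m * l) + 3`, and the root is at least `1`. -/
theorem size_le_sqrt : (size n m l : ℝ) ≤ 4 * √((m : ℝ) * l) := by
  have hk := h.k_le
  have hkp := h.k_pos
  have hml : 1 ≤ m * l := Nat.mul_pos h.m_pos h.l_pos
  have h1 : m * l ≤ (size n m l - 2) * (size n m l - 2) :=
    mul_le_size_sub_sq h.m_le h.l_le (by omega)
  have h3 : 2 < size n m l := by
    by_contra hcon
    have : size n m l - 2 = 0 := by omega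
    rw [this] at h1
    omega
  have h2 := size_sub_sq_lt (n := n) h.m_le h.l_le (by omega) h3
  have h4 : (1 : ℝ) ≤ √((m : ℝ) * l) := by
    rw [Real.one_le_sqrt]
    exact_mod_cast hml
  have h5 : ((size n m l - 3 : ℕ) : ℝ) ≤ √((m : ℝ) * l) := by
    refine Real.le_sqrt_of_sq_le ?_
    rw [sq]
    exact_mod_cast h2.le
  have h6 : (size n m l : ℝ) = ((size n m l - 3 : ℕ) : ℝ) + 3 := by
    have : size n m l = size n m l - 3 + 3 := by omega
    exact_mod_cast this
  linarith

open Classical in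
theorem card_link_le_sqrt (x : ℕ) :
    (((Finset.range n).filter fun y => Link G m k l x y).card : ℝ) ≤
      256 * C * √((m : ℝ) * l) := by
  rcases lt_or_ge m l with hlt | hle
  · have h1 : (((Finset.range n).filter fun y => Link G m k l x y).card : ℝ) ≤ 3 * C * m := by
      exact_mod_cast h.card_link_le_of_lt hlt x
    refine h1.trans (mul_le_mul ?_ (le_sqrt_mul hlt.le) (by positivity) (by positivity))
    gcongr
    norm_num
  · have h1 : (((Finset.range n).filter fun y => Link G m k l x y).card : ℝ) ≤
        64 * C * size n m l := by
      exact_mod_cast h.card_link_le hle x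
    refine h1.trans ((mul_le_mul_of_nonneg_left h.size_le_sqrt (by positivity)).trans_eq (by ring))

/-- Each new edge is charged to the endpoint where its link starts, so the bound on outgoing links
suffices. This includes hubs, which receive links from all other vertices. -/
theorem ncard_edgeSet_le :
    (((output G m k l).edgeSet \ G.edgeSet).ncard : ℝ) ≤ 256 * C * √((m : ℝ) * l) * n := by
  classical
  let B : Finset (Sym2 (Fin n)) := Finset.univ.biUnion fun x : Fin n =>
    (Finset.univ.filter fun y : Fin n => Link G m k l x y).image fun y => s(x, y)
  have h1 : ((output G m k l).edgeSet \ G.edgeSet) ⊆ (B : Set (Sym2 (Fin n))) := by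
    intro e
    induction e with
    | _ x y =>
      simp only [Set.mem_sdiff, SimpleGraph.mem_edgeSet, B, Finset.coe_biUnion, Finset.coe_image,
        Set.mem_iUnion, Set.mem_image, Finset.mem_coe, Finset.mem_univ, Finset.mem_filter, true_and]
      rintro ⟨hadj | ⟨-, -, -, hl | hl⟩, hG⟩
      · exact absurd hadj hG
      · exact ⟨x, trivial, y, hl, rfl⟩
      · exact ⟨y, trivial, x, hl, Sym2.eq_swap⟩
  have h2 : ((output G m k l).edgeSet \ G.edgeSet).ncard ≤ B.card := by
    rw [← Set.ncard_coe_finset]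
    exact Set.ncard_le_ncard h1 (Set.toFinite _)
  have h3 : (B.card : ℝ) ≤ ∑ x : Fin n, 256 * C * √((m : ℝ) * l) := by
    refine le_trans (Nat.cast_le.2 Finset.card_biUnion_le) ?_
    rw [Nat.cast_sum]
    refine Finset.sum_le_sum fun x _ => le_trans (Nat.cast_le.2 Finset.card_image_le) ?_
    refine le_trans (le_of_eq ?_) (h.card_link_le_sqrt (G := G) x)
    rw [card_filter_range, ← Set.ncard_coe_finset]
    simp
  rw [Finset.sum_const, Finset.card_univ, Fintype.card_fin, nsmul_eq_mul, mul_comm] at h3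
  exact le_trans (Nat.cast_le.2 h2) h3

/-- At a single vertex both directions count; incoming links are under control only in the
construction with blocks. -/
theorem ncard_neighborSet_le (hle : l ≤ m) (v : Fin n) :
    (((output G m k l).neighborSet v \ G.neighborSet v).ncard : ℝ) ≤
      600 * C * √((m : ℝ) * l) := by
  classical
  have h1 : ((output G m k l).neighborSet v \ G.neighborSet v) ⊆
      {y : Fin n | Link G m k l v y} ∪ {y : Fin n | Link G m k l y v} := by
    rintro y ⟨hadj | ⟨-, -, -, hl⟩, hG⟩
    · exact absurd hadj hG
    · exact hl
  have h2 := (Set.ncard_le_ncard h1 (Set.toFinite _)).trans (Set.ncard_union_le _ _)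
  rw [← card_filter_range (P := fun y => Link G m k l v y),
    ← card_filter_range (P := fun y => Link G m k l y v)] at h2
  have h3 := h.card_link_le hle (G := G) v
  have h4 := h.card_link_le' hle (G := G) v
  have h5 : ((output G m k l).neighborSet v \ G.neighborSet v).ncard ≤
      131 * C * size n m l := by
    refine h2.trans ((add_le_add h3 h4).trans_eq ?_)
    ring
  have h6 : (((output G m k l).neighborSet v \ G.neighborSet v).ncard : ℝ) ≤
      131 * C * size n m l := by
    exact_mod_cast h5
  refine h6.trans ((mul_le_mul_of_nonneg_left h.size_le_sqrt (by positivity)).trans ?_)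
  have : (0 : ℝ) ≤ C * √((m : ℝ) * l) := by positivity
  linarith

end Sparse

/-! ### Large numbers of vertices -/

-- Take `D = ⌈n ^ (ε / 2)⌉` and `C > 4 / ε`. Then `D ^ C ≥ n ^ 2 > n`, and `D * k ≤ 2 * n ^ (1 - ε /
-- 2)`, so `200 * C * D * k ≤ n` as soon as `n ^ (ε / 2) ≥ 400 * C`.
open Filter in
theorem exists_sparse {ε : ℝ} (hε : 0 < ε) : ∃ C n₀ : ℕ, 3 < n₀ ∧ 0 < C ∧ ∀ n ≥ n₀, ∀ k : ℕ, 0 < k →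
    (k : ℝ) ≤ (n : ℝ) ^ (1 - ε) → ∃ D : ℕ, 2 ≤ D ∧ n < D ^ C ∧ 200 * (C * D * k) ≤ n := by
  set C := ⌈4 / ε⌉₊ + 1 with hC
  have ht : Tendsto (fun n : ℕ => (n : ℝ) ^ (ε / 2)) atTop atTop :=
    (tendsto_rpow_atTop (half_pos hε)).comp tendsto_natCast_atTop_atTop
  obtain ⟨n₁, hn₁⟩ := eventually_atTop.1 (ht.eventually_ge_atTop (400 * C : ℝ))
  refine ⟨C, max n₁ 4, by omega, by omega, fun n hn k hk hkn => ?_⟩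
  have hbig := hn₁ n (by omega)
  have hn2 : (1 : ℝ) < n := by exact_mod_cast (by omega : 1 < n)
  have hn0 : (0 : ℝ) < n := by linarith
  have hC1 : (1 : ℝ) ≤ C := by exact_mod_cast (by omega : 1 ≤ C)
  set y : ℝ := (n : ℝ) ^ (ε / 2) with hy
  have hy0 : 0 < y := by positivity
  have hD1 : y ≤ ⌈y⌉₊ := Nat.le_ceil y
  have hD2 : (⌈y⌉₊ : ℝ) ≤ 2 * y := by
    have := Nat.ceil_lt_add_one hy0.le
    linarith
  refine ⟨⌈y⌉₊, ?_, ?_, ?_⟩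
  · have : (2 : ℝ) ≤ (⌈y⌉₊ : ℝ) := by linarith
    exact_mod_cast this
  · have h1 : (n : ℝ) < y ^ C := by
      rw [hy, ← Real.rpow_natCast, ← Real.rpow_mul hn0.le]
      conv_lhs => rw [← Real.rpow_one (n : ℝ)]
      refine Real.rpow_lt_rpow_of_exponent_lt hn2 ?_
      have h2 : 4 / ε ≤ (C : ℝ) := by
        rw [hC]
        push_cast
        have := Nat.le_ceil (4 / ε)
        linarith
      rw [div_le_iff₀ hε] at h2
      linarith
    have h3 : (n : ℝ) < ((⌈y⌉₊ ^ C : ℕ) : ℝ) := by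
      push_cast
      exact h1.trans_le (pow_le_pow_left₀ hy0.le hD1 C)
    exact_mod_cast h3
  · have h1 : y * y * (n : ℝ) ^ (1 - ε) = n := by
      rw [hy, ← Real.rpow_add hn0, ← Real.rpow_add hn0]
      conv_rhs => rw [← Real.rpow_one (n : ℝ)]
      congr 1
      ring
    have h2 : (200 * (C * ⌈y⌉₊ * k) : ℝ) ≤ 200 * (C * (2 * y) * (n : ℝ) ^ (1 - ε)) := by
      gcongr
    have h3 : 200 * (C * (2 * y) * (n : ℝ) ^ (1 - ε)) ≤ y * (y * (n : ℝ) ^ (1 - ε)) := by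
      have : 0 ≤ y * (n : ℝ) ^ (1 - ε) := by positivity
      calc _ = 400 * C * (y * (n : ℝ) ^ (1 - ε)) := by ring
        _ ≤ _ := mul_le_mul_of_nonneg_right hbig this
    have h4 : (200 * (C * ⌈y⌉₊ * k) : ℝ) ≤ n := by
      rw [← mul_assoc y, h1] at h3
      exact h2.trans h3
    exact_mod_cast h4

/-- In this degenerate case the bound `√(m * l)` is `0`, so not a single edge may be added, not even
the cliques of shift `0`. -/
theorem output_eq_self (h : ¬ (0 < m ∧ 0 < l)) : output G m k l = G := by
  ext x y
  simp only [output]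
  tauto

theorem isAnonymous_zero (hk : k < n) : IsAnonymous G k 0 := by
  intro v
  refine ⟨Finset.univ.erase v, by simp, ?_, fun u _ => Nat.zero_le _⟩
  rw [Finset.card_erase_of_mem (Finset.mem_univ v), Finset.card_univ, Fintype.card_fin]
  omega

end Anonymization

/-! ### Uniqueness of the output and conclusion. -/

theorem adjEntry_injective {n : ℕ} {G H : SimpleGraph (Fin n)}
    (h : ∀ x y : Fin n, adjEntry G x y = adjEntry H x y) : G = H := by
  classical
  ext x y
  have := h x y
  rw [Anonymizer.adjEntry_coe, Anonymizer.adjEntry_coe] at this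
  by_cases h1 : G.Adj x y <;> by_cases h2 : H.Adj x y <;> simp_all

/-- Given the coins, the output of a program is unique. -/
theorem Outputs.unique {A : Program} {n : ℕ} {G G₁ G₂ : SimpleGraph (Fin n)} {k₀ k l : ℕ}
    {ω : ℕ → Bool} {t₁ t₂ : ℕ} (h₁ : Outputs A G k₀ k l ω t₁ G₁)
    (h₂ : Outputs A G k₀ k l ω t₂ G₂) : G₁ = G₂ := by
  obtain ⟨s₁, he₁, ha₁⟩ := h₁
  obtain ⟨s₂, he₂, ha₂⟩ := h₂
  obtain ⟨-, rfl⟩ := he₁.deterministic he₂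
  exact adjEntry_injective fun x y => (ha₁ x y).symm.trans (ha₂ x y)

theorem coinProb_eq_one {m : ℕ} {E : (ℕ → Bool) → Prop} (h : ∀ ω, E ω) : coinProb m E = 1 := by
  classical
  unfold coinProb
  rw [Finset.filter_true_of_mem fun r _ => h _]
  simp

open Anonymization Anonymizer in
theorem mainTheorem9 :
    ∃ (A : Program) (T : Polynomial ℕ), RunsInTime A (fun n => T.eval n) ∧
      ∀ ε : ℝ, 0 < ε → ∃ (C : ℝ) (n₀ : ℕ), ∀ n : ℕ, n₀ ≤ n →
        ∀ k₀ k l : ℕ, k₀ ≤ k → l ≤ k → (k : ℝ) ≤ (n : ℝ) ^ (1 - ε) →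
        ∀ G : SimpleGraph (Fin n), IsAnonymous G k₀ l →
          (∀ (ω : ℕ → Bool) (t : ℕ) (G₁ : SimpleGraph (Fin n)), Outputs A G k₀ k l ω t G₁ →
            G ≤ G₁ ∧
            ((G₁.edgeSet \ G.edgeSet).ncard : ℝ) ≤ C * √(((k : ℝ) - k₀) * l) * n ∧
            (l ≤ k - k₀ → ∀ v : Fin n,
              ((G₁.neighborSet v \ G.neighborSet v).ncard : ℝ) ≤ C * √(((k : ℝ) - k₀) * l))) ∧
          1 - 1 / (n : ℝ) ≤ coinProb (T.eval n) (fun ω =>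
            ∃ (t : ℕ) (G₁ : SimpleGraph (Fin n)),
              Outputs A G k₀ k l ω t G₁ ∧ IsAnonymous G₁ k l) := by
  obtain ⟨K, hK⟩ := program_outputs
  refine ⟨program, Polynomial.C K * (Polynomial.X + 1) ^ 4, ?_, fun ε hε => ?_⟩
  · intro n G k₀ k l ω
    obtain ⟨t, ht, G₁, ho, -⟩ := hK n G k₀ k l ω
    exact ⟨t, by simpa using ht, G₁, ho⟩
  obtain ⟨C, n₀, hn₀, hC, hsparse⟩ := exists_sparse hε
  refine ⟨600 * C, n₀, fun n hn k₀ k l hk₀ hl hk G hG => ?_⟩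
  have hkn : k + 2 < n := by
    rcases Nat.eq_zero_or_pos k with rfl | hpos
    · omega
    · obtain ⟨D, hD, -, hle⟩ := hsparse n hn k hpos hk
      have : 1 * k ≤ C * D * k := Nat.mul_le_mul_right _ (Nat.mul_pos hC (by omega))
      omega
  have hsmall : SmallParameters n k₀ k l := by
    have := size_le (n := n) (Nat.sub_le k k₀) hl (by omega)
    exact ⟨by omega, by omega, by omega⟩
  have hout : ∀ ω, ∃ t, Outputs program G k₀ k l ω t (output G (k - k₀) k l) := by
    intro ω
    obtain ⟨t, -, G₁, ho, h⟩ := hK n G k₀ k l ω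
    exact ⟨t, h hsmall ▸ ho⟩
  have hcast : (k : ℝ) - k₀ = ((k - k₀ : ℕ) : ℝ) := (Nat.cast_sub hk₀).symm
  rw [hcast]
  suffices h : IsAnonymous (output G (k - k₀) k l) k l ∧
      (((output G (k - k₀) k l).edgeSet \ G.edgeSet).ncard : ℝ) ≤
        600 * C * √(((k - k₀ : ℕ) : ℝ) * l) * n ∧
      (l ≤ k - k₀ → ∀ v : Fin n,
        (((output G (k - k₀) k l).neighborSet v \ G.neighborSet v).ncard : ℝ) ≤
          600 * C * √(((k - k₀ : ℕ) : ℝ) * l)) by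
    constructor
    · intro ω t G₁ ho
      obtain ⟨t', ho'⟩ := hout ω
      obtain rfl := ho.unique ho'
      exact ⟨fun _ _ => Or.inl, h.2⟩
    · rw [coinProb_eq_one fun ω => ?_]
      · have : (0 : ℝ) ≤ 1 / n := by positivity
        linarith
      · obtain ⟨t, ho⟩ := hout ω
        exact ⟨t, _, ho, h.1⟩
  by_cases hpos : 0 < k - k₀ ∧ 0 < l
  · obtain ⟨D, hD, hpow, hle⟩ := hsparse n hn k (by omega) hk
    have hs : Sparse n (k - k₀) k l D C :=
      ⟨hpos.1, hpos.2, Nat.sub_le k k₀, hl, hD, hC, hpow, hle⟩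
    -- With hubs `k - k₀ < l ≤ k`, which gives `0 < k₀`.
    refine ⟨hs.isAnonymous_output (by omega) (fun h => by omega) hG,
      hs.ncard_edgeSet_le.trans ?_, hs.ncard_neighborSet_le⟩
    gcongr
    norm_num
  · rw [output_eq_self hpos]
    refine ⟨?_, ?_, fun _ v => ?_⟩
    · rcases Nat.eq_zero_or_pos l with rfl | hl0
      · exact isAnonymous_zero (by omega)
      · obtain rfl : k₀ = k := by omega
        exact hG
    · rw [sdiff_self, Set.bot_eq_empty, Set.ncard_empty, Nat.cast_zero]
      positivity
    · rw [sdiff_self, Set.bot_eq_empty, Set.ncard_empty, Nat.cast_zero]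
      positivity
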